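/- For an integer $k\ge 1$ let $\Lambda_k=\Lambda*\cdots*\Lambda$ be the $k$-fold Dirichlet convolution of the von Mangoldt function $\Lambda$ with itself, equivalently $\left(-\frac{\zeta'}{\zeta}(s)\right)^k=\sum_{n\ge1}\Lambda_k(n)n^{-s}$ for $\operatorname{Re}s>1$. For real $x\ge 1$ and integers $k,\ell\ge 1$ put $$S_{k,\ell}(x)=\sum_{n\le x}\Lambda_k(n)\Lambda_\ell(n).$$ (1) If $k>\ell\ge 1$, then $$S_{k,\ell}(x)\ll x\log^{k+\ell-2}x .$$ (2) If $k\ge 1$, then $$S_{k,k}(x)=\frac{k!}{(2k-1)!}\,x\log^{2k-1}x+O\!\left(x\log^{2k-2}x\right).$$ Both estimates hold for all real $x\ge 1$, with implied constants that depend at most on $k$ and $\ell$ (with the convention $\log^0 x=1$ for all $x\ge1$, including $x=1$). -/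

import Mathlib

noncomputable section

/-- `Λ_k`, the `k`-fold Dirichlet convolution `Λ * ⋯ * Λ` of the von Mangoldt function.
The product of arithmetic functions in Mathlib is Dirichlet convolution, and `Λ_0` is its unit. -/
def vonMangoldtConv (k : ℕ) : ArithmeticFunction ℝ :=
  ArithmeticFunction.vonMangoldt ^ k

/-- `S_{k,l}(x) = ∑_{n ≤ x} Λ_k(n) Λ_l(n)`, over the positive integers `n ≤ x`. -/
def vonMangoldtConvSum (k l : ℕ) (x : ℝ) : ℝ :=
  ∑ n ∈ Finset.Icc 1 ⌊x⌋₊, vonMangoldtConv k n * vonMangoldtConv l n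

/-- The recursion `Λ_{k+1}(n) = ∑_{d ∣ n} Λ(d) Λ_k(n / d)`. -/
theorem vonMangoldtConv_succ_apply (k n : ℕ) :
    vonMangoldtConv (k + 1) n =
      ∑ d ∈ n.divisors, ArithmeticFunction.vonMangoldt d * vonMangoldtConv k (n / d) := by
  rw [vonMangoldtConv, pow_succ', ArithmeticFunction.mul_apply,
    Nat.sum_divisorsAntidiagonal (f := fun a b =>
      ArithmeticFunction.vonMangoldt a * (ArithmeticFunction.vonMangoldt ^ k) b)]
  rfl

end

/-! At a squarefree `n`, `Λ_k(n)` is `k! ∏_{p ∣ n} log p` if `n` has exactly `k` prime factors, and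
`0` otherwise. For `k ≠ l` the product `Λ_k Λ_l` therefore vanishes at squarefree integers, while
`Λ_k² = k! (Λ²)^{*k}` holds there exactly. Both claims reduce to showing that non-squarefree `n` are
negligible and to evaluating `∑_{n ≤ x} (Λ²)^{*k}(n)`.

Non-squarefree integers: since `Λ_k ≤ log^k`, it suffices that the sum of `Λ_l` over non-squarefree
`n ≤ x` is `≪ x log^{l-2} x`, one logarithm below the full sum. The part of `Λ_l` on non-squarefree
integers is dominated by convolutions `w * Λ_j`, `j < l`, with a weight `w` on proper prime powers
for which `∑ w(m)(1 + log m)/m` converges; Chebyshev and Mertens bounds finish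
(`exists_sum_log_pow_mul_nonSquarefreePart_le`).

Main term: `∑_{n ≤ x} Λ(n)² = x log x + O(x)`, and induction on `k` by Abel summation gives `x
log^{2k-1} x/(2k-1)! + O(x log^{2k-2} x)` for `(Λ²)^{*k}`; each step contributes the integral of `(L
- v) v^m` over `[0, L]`, `L = log x`.

The base case requires the prime number theorem in the form `ψ(x) = x + O(x / log x)`. Its proof is
by mean squares. The Laplace transform of `ψ(eᵘ) - eᵘ` is `-(1 + H'/H)/s` with `H(s) = (s - 1)
ζ(s)`. Upper bounds for `H` and its derivatives, with a lower bound from the 3-4-1 inequality, make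
its second derivative `O(|t|^{-7/10})` for large `|t|`, uniformly as `Re s → 1+`. Plancherel then
bounds the `L²` norm of `u² (ψ(eᵘ) - eᵘ) e^{-σu}` uniformly in `σ`, and monotonicity of `ψ` turns
this into a pointwise estimate. -/

/-! ### Plancherel's identity on `L¹ ∩ L²`. -/

open MeasureTheory FourierTransform Filter in
open scoped SchwartzMap ContDiff in
/-- The `L²` Fourier transform of an integrable square-integrable function is given by the
Fourier integral. -/
theorem fourier_toLp_ae_eq {f : ℝ → ℂ} (hf : Integrable f) (hf2 : MemLp f 2) :
    (𝓕 (hf2.toLp f) : Lp ℂ 2 (volume : Measure ℝ)) =ᵐ[volume] 𝓕 f := by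
  set g : Lp ℂ 2 (volume : Measure ℝ) := 𝓕 (hf2.toLp f) with hg
  have hcont : Continuous (𝓕 f) :=
    VectorFourier.fourierIntegral_continuous Real.continuous_fourierChar
      (by exact continuous_inner) hf
  have hgl : LocallyIntegrable (g : ℝ → ℂ) :=
    (Lp.memLp g).locallyIntegrable (by norm_num)
  refine ae_eq_of_integral_contDiff_smul_eq hgl hcont.locallyIntegrable ?_
  intro φ hφ hφc
  have hφ' : ContDiff ℝ ∞ (fun x => (φ x : ℂ)) := Complex.ofRealCLM.contDiff.comp hφ
  have hφc' : HasCompactSupport (fun x => (φ x : ℂ)) :=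
    hφc.comp_left (g := fun x : ℝ => (x : ℂ)) (by simp)
  set Φ : 𝓢(ℝ, ℂ) := hφc'.toSchwartzMap hφ' with hΦ
  have hΦx : ∀ x, Φ x = (φ x : ℂ) := fun x => rfl
  -- The `L²` transform agrees with the distributional one, so testing against `Φ` moves the
  -- transform onto `Φ`; the multiplication formula `h4` moves it back onto `f` as a Fourier
  -- integral.
  have h1 := Lp.fourier_toTemperedDistribution_eq (hf2.toLp f)
  have h2 := congrArg (fun T => T Φ) h1
  simp only [TemperedDistribution.fourier_apply, Lp.toTemperedDistribution_apply] at h2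
  have h3 : ∫ x, (𝓕 Φ) x • (hf2.toLp f) x = ∫ x, (𝓕 Φ) x • f x := by
    refine integral_congr_ae ?_
    filter_upwards [hf2.coeFn_toLp] with x hx
    rw [hx]
  have h4 := VectorFourier.integral_fourierIntegral_smul_eq_flip (L := innerₗ ℝ)
    (μ := volume) (ν := volume) (f := (Φ : ℝ → ℂ)) (g := f) Real.continuous_fourierChar
      (by exact continuous_inner) Φ.integrable hf
  have h5 : ∀ x, (φ x) • (g x) = Φ x • g x := fun x => by simp [hΦx]
  have h6 : ∀ x, (φ x) • (𝓕 f x) = Φ x • 𝓕 f x := fun x => by simp [hΦx]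
  simp_rw [h5, h6]
  rw [← h2, h3, SchwartzMap.fourier_coe]
  rw [flip_innerₗ] at h4
  exact h4

open MeasureTheory FourierTransform in
/-- Plancherel's identity for integrable square-integrable functions. -/
theorem eLpNorm_fourier_eq {f : ℝ → ℂ} (hf : Integrable f) (hf2 : MemLp f 2) :
    eLpNorm (𝓕 f) 2 volume = eLpNorm f 2 volume := by
  have h := Lp.norm_fourier_eq (hf2.toLp f)
  rw [Lp.norm_def, Lp.norm_def, ENNReal.toReal_eq_toReal_iff' (Lp.eLpNorm_ne_top _)
    (Lp.eLpNorm_ne_top _), eLpNorm_congr_ae (fourier_toLp_ae_eq hf hf2),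
    eLpNorm_congr_ae hf2.coeFn_toLp] at h
  exact h

open MeasureTheory FourierTransform in
/-- Plancherel's identity in terms of integrals. -/
theorem integral_norm_fourier_sq_eq {f : ℝ → ℂ} (hf : Integrable f) (hf2 : MemLp f 2) :
    ∫ x, ‖𝓕 f x‖ ^ 2 = ∫ x, ‖f x‖ ^ 2 := by
  have h := eLpNorm_fourier_eq hf hf2
  have hF2 : MemLp (𝓕 f) 2 volume :=
    ⟨(VectorFourier.fourierIntegral_continuous Real.continuous_fourierChar
      (by exact continuous_inner) hf).aestronglyMeasurable, by rw [h]; exact hf2.2⟩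
  have e1 := hF2.eLpNorm_eq_integral_rpow_norm (by norm_num) (by norm_num)
  have e2 := hf2.eLpNorm_eq_integral_rpow_norm (by norm_num) (by norm_num)
  rw [h, e2] at e1
  have e3 := (ENNReal.ofReal_eq_ofReal_iff (by positivity) (by positivity)).1 e1
  have e4 := (Real.rpow_left_inj (by positivity) (by positivity) (by norm_num)).1 e3
  simpa using e4.symm

/-! ### Continuation and growth of `(s - 1) ζ(s)`. -/

/-- The `n`-th term of the series for `(s - 1) ζ(s) - 1`. -/
noncomputable def zetaTerm (n : ℕ) (s : ℂ) : ℂ :=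
  (s - 1) * ((n + 1 : ℝ) : ℂ) ^ (-s) + ((n + 2 : ℝ) : ℂ) ^ (1 - s) - ((n + 1 : ℝ) : ℂ) ^ (1 - s)

/-- `(s - 1) ζ(s)`, given by a series converging for `Re s > 0`. -/
noncomputable def zetaMulSub (s : ℂ) : ℂ := 1 + ∑' n, zetaTerm n s

theorem hasDerivAt_ofReal_cpow_neg {x : ℝ} (hx : 0 < x) {s : ℂ} (hs : s ≠ 0) :
    HasDerivAt (fun y : ℝ => (y : ℂ) ^ (-s)) (-s * (x : ℂ) ^ (-s - 1)) x :=
  hasDerivAt_ofReal_cpow_const hx.ne' (neg_ne_zero.2 hs)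

theorem norm_cpow_neg_sub_le {a x : ℝ} (ha : 0 < a) (hx : a ≤ x) (hx1 : x ≤ a + 1) {s : ℂ}
    (hs : 0 < s.re) :
    ‖(x : ℂ) ^ (-s) - (a : ℂ) ^ (-s)‖ ≤ ‖s‖ * a ^ (-s.re - 1) := by
  have hs0 : s ≠ 0 := by rintro rfl; simp at hs
  have h := Convex.norm_image_sub_le_of_norm_hasDerivWithin_le (s := Set.Icc a (a + 1))
    (f := fun y : ℝ => (y : ℂ) ^ (-s)) (f' := fun y => -s * (y : ℂ) ^ (-s - 1))
    (C := ‖s‖ * a ^ (-s.re - 1)) (x := a) (y := x)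
    (fun y hy => (hasDerivAt_ofReal_cpow_neg (ha.trans_le hy.1) hs0).hasDerivWithinAt)
    (fun y hy => by
      rw [norm_mul, norm_neg, Complex.norm_cpow_eq_rpow_re_of_pos (ha.trans_le hy.1)]
      simp only [Complex.sub_re, Complex.neg_re, Complex.one_re]
      gcongr ?_ * ?_
      exact Real.rpow_le_rpow_of_nonpos ha hy.1 (by linarith)) (convex_Icc _ _)
    ⟨le_rfl, by linarith⟩ ⟨hx, hx1⟩
  refine h.trans ?_
  have : ‖x - a‖ ≤ 1 := by rw [Real.norm_eq_abs, abs_le]; constructor <;> linarith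
  exact mul_le_of_le_one_right (by positivity) this

theorem norm_cpow_neg_sub_le_two_mul {a x : ℝ} (ha : 0 < a) (hx : a ≤ x) {s : ℂ}
    (hs : 0 < s.re) :
    ‖(x : ℂ) ^ (-s) - (a : ℂ) ^ (-s)‖ ≤ 2 * a ^ (-s.re) := by
  refine (norm_sub_le _ _).trans ?_
  rw [Complex.norm_cpow_eq_rpow_re_of_pos (ha.trans_le hx),
    Complex.norm_cpow_eq_rpow_re_of_pos ha, Complex.neg_re]
  have := Real.rpow_le_rpow_of_nonpos ha hx (by linarith : -s.re ≤ 0)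
  linarith

/-- Interpolation between the mean value bound and the trivial bound: with `r = ‖s‖ / a`, the
minimum of `1` and `r` is at most `r ^ θ`. A small `θ` buys convergence slightly left of `Re s = 1`
at a cost of only `‖s‖ ^ θ`. -/
theorem norm_cpow_neg_sub_le_rpow {a x θ : ℝ} (ha : 0 < a) (hx : a ≤ x) (hx1 : x ≤ a + 1) {s : ℂ}
    (hs : 0 < s.re) (hθ : 0 ≤ θ) (hθ1 : θ ≤ 1) :
    ‖(x : ℂ) ^ (-s) - (a : ℂ) ^ (-s)‖ ≤ 2 * ‖s‖ ^ θ * a ^ (-s.re - θ) := by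
  have e : a ^ (-s.re - θ) = a ^ (-s.re) / a ^ θ := Real.rpow_sub ha _ _
  have e1 : a ^ (-s.re - 1) = a ^ (-s.re) / a := by rw [Real.rpow_sub ha, Real.rpow_one]
  have key : 2 * ‖s‖ ^ θ * a ^ (-s.re - θ) = 2 * a ^ (-s.re) * (‖s‖ / a) ^ θ := by
    rw [e, Real.div_rpow (norm_nonneg _) ha.le]; ring
  rw [key]
  rcases le_total (‖s‖ / a) 1 with h | h
  · refine (norm_cpow_neg_sub_le ha hx hx1 hs).trans ?_
    have h1 : ‖s‖ / a ≤ (‖s‖ / a) ^ θ := by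
      have hs0 : 0 < ‖s‖ / a := div_pos (norm_pos_iff.2 (by rintro rfl; simp at hs)) ha
      simpa using Real.rpow_le_rpow_of_exponent_ge hs0 h hθ1
    have h2 : 0 ≤ a ^ (-s.re) := by positivity
    calc ‖s‖ * a ^ (-s.re - 1) = a ^ (-s.re) * (‖s‖ / a) := by rw [e1]; ring
      _ ≤ a ^ (-s.re) * (‖s‖ / a) ^ θ := by gcongr
      _ ≤ _ := by
        have : 0 ≤ a ^ (-s.re) * (‖s‖ / a) ^ θ := by positivity
        linarith
  · refine (norm_cpow_neg_sub_le_two_mul ha hx hs).trans ?_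
    exact le_mul_of_one_le_right (by positivity) (Real.one_le_rpow h hθ)

/-- With `a = n + 1`, the term is the increment over `[a, a + 1]` of `y ^ (1 - s) + (s - 1) a ^ (-s)
y`, whose derivative is `-(s - 1)(y ^ (-s) - a ^ (-s))`; the mean value inequality applies. -/
theorem norm_zetaTerm_le (n : ℕ) {s : ℂ} {θ : ℝ} (hs : 0 < s.re) (hθ : 0 ≤ θ) (hθ1 : θ ≤ 1) :
    ‖zetaTerm n s‖ ≤ 2 * ‖s - 1‖ * ‖s‖ ^ θ * (n + 1 : ℝ) ^ (-s.re - θ) := by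
  rcases eq_or_ne s 1 with rfl | h1
  · simp [zetaTerm]
  set a : ℝ := n + 1 with ha
  have ha0 : 0 < a := by positivity
  have h1' : s - 1 ≠ 0 := sub_ne_zero.2 h1
  have h := Convex.norm_image_sub_le_of_norm_hasDerivWithin_le (s := Set.Icc a (a + 1))
    (f := fun y : ℝ => (y : ℂ) ^ (-(s - 1)) - (-(s - 1)) * (a : ℂ) ^ (-s) * y)
    (f' := fun y => -(s - 1) * (y : ℂ) ^ (-(s - 1) - 1) - (-(s - 1)) * (a : ℂ) ^ (-s) * 1)
    (C := 2 * ‖s - 1‖ * ‖s‖ ^ θ * a ^ (-s.re - θ)) (x := a) (y := a + 1)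
    (fun y hy => ((hasDerivAt_ofReal_cpow_neg (ha0.trans_le hy.1) h1').sub
      ((hasDerivAt_id y).ofReal_comp.const_mul _)).hasDerivWithinAt)
    (fun y hy => by
      have : -(s - 1) * (y : ℂ) ^ (-(s - 1) - 1) - (-(s - 1)) * (a : ℂ) ^ (-s) * 1
        = -(s - 1) * ((y : ℂ) ^ (-s) - (a : ℂ) ^ (-s)) := by
        rw [show -(s - 1) - 1 = -s by ring]; ring
      rw [this, norm_mul, norm_neg]
      have := norm_cpow_neg_sub_le_rpow ha0 hy.1 hy.2 hs hθ hθ1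
      calc ‖s - 1‖ * ‖(y : ℂ) ^ (-s) - (a : ℂ) ^ (-s)‖
          ≤ ‖s - 1‖ * (2 * ‖s‖ ^ θ * a ^ (-s.re - θ)) := by gcongr
        _ = _ := by ring)
    (convex_Icc _ _) ⟨le_rfl, by linarith⟩ ⟨by linarith, le_rfl⟩
  have e : zetaTerm n s = (((a + 1 : ℝ) : ℂ) ^ (-(s - 1)) -
      (-(s - 1)) * (a : ℂ) ^ (-s) * ((a + 1 : ℝ) : ℂ))
      - ((a : ℂ) ^ (-(s - 1)) - (-(s - 1)) * (a : ℂ) ^ (-s) * (a : ℂ)) := by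
    rw [zetaTerm, show (n + 2 : ℝ) = a + 1 by rw [ha]; ring, ← ha,
      show -(s - 1) = 1 - s by ring, Complex.ofReal_add a 1, Complex.ofReal_one]
    ring
  rw [e]
  simpa using h

theorem norm_zetaTerm_le_of_re (n : ℕ) {s : ℂ} (hs : 99 / 100 ≤ s.re) :
    ‖zetaTerm n s‖ ≤
      2 * ‖s - 1‖ * ‖s‖ ^ (1 / 50 : ℝ) * (1 / (n + 1 : ℝ) ^ (101 / 100 : ℝ)) := by
  -- For `Re s ≥ 99/100`, `θ = 1/50` gives the summable exponent `-101/100`, and total growth `‖s‖ ^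
  -- (1 + 1/50)`, the source of `51/50` below.
  refine (norm_zetaTerm_le n (θ := 1 / 50) (by linarith) (by norm_num) (by norm_num)).trans ?_
  rw [one_div ((n + 1 : ℝ) ^ (101 / 100 : ℝ)), ← Real.rpow_neg (by positivity)]
  have h : (1 : ℝ) ≤ n + 1 := by linarith [(Nat.cast_nonneg n : (0 : ℝ) ≤ n)]
  gcongr ?_ * ?_
  exact Real.rpow_le_rpow_of_exponent_le h (by linarith)

theorem summable_one_div_add_one_rpow {p : ℝ} (hp : 1 < p) :
    Summable fun n : ℕ => 1 / (n + 1 : ℝ) ^ p := by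
  have := (summable_nat_add_iff 1).2 (Real.summable_one_div_nat_rpow.2 hp)
  simpa using this

theorem summable_zetaTerm {s : ℂ} (hs : 99 / 100 ≤ s.re) : Summable fun n => zetaTerm n s :=
  Summable.of_norm_bounded ((summable_one_div_add_one_rpow (by norm_num)).mul_left _)
    fun n => norm_zetaTerm_le_of_re n hs

theorem differentiable_zetaTerm (n : ℕ) : Differentiable ℂ (zetaTerm n) := by
  have h1 : ((n + 1 : ℝ) : ℂ) ≠ 0 := by exact_mod_cast (by positivity : (n + 1 : ℝ) ≠ 0)
  have h2 : ((n + 2 : ℝ) : ℂ) ≠ 0 := by exact_mod_cast (by positivity : (n + 2 : ℝ) ≠ 0)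
  have : zetaTerm n = fun s => (s - 1) * ((n + 1 : ℝ) : ℂ) ^ (-s) + ((n + 2 : ℝ) : ℂ) ^ (1 - s)
      - ((n + 1 : ℝ) : ℂ) ^ (1 - s) := rfl
  rw [this]
  refine Differentiable.sub (Differentiable.add (Differentiable.mul (by fun_prop) ?_) ?_) ?_
  · exact Differentiable.const_cpow (by fun_prop) (Or.inl h1)
  · exact Differentiable.const_cpow (by fun_prop) (Or.inl h2)
  · exact Differentiable.const_cpow (by fun_prop) (Or.inl h1)

theorem differentiableAt_zetaMulSub {s : ℂ} (hs : 99 / 100 < s.re) :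
    DifferentiableAt ℂ zetaMulSub s := by
  set U : Set ℂ := {z | 99 / 100 < z.re} ∩ Metric.ball 0 (‖s‖ + 1) with hU
  have hUo : IsOpen U :=
    (isOpen_lt continuous_const Complex.continuous_re).inter Metric.isOpen_ball
  have hsU : s ∈ U := ⟨hs, by simp⟩
  have h : DifferentiableOn ℂ (fun z => ∑' n, zetaTerm n z) U := by
    refine Complex.differentiableOn_tsum_of_summable_norm
      (u := fun n : ℕ => 2 * (‖s‖ + 2) * (‖s‖ + 1) ^ (1 / 50 : ℝ) *
        (1 / (n + 1 : ℝ) ^ (101 / 100 : ℝ)))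
      ((summable_one_div_add_one_rpow (by norm_num)).mul_left _)
      (fun n => (differentiable_zetaTerm n).differentiableOn) hUo ?_
    intro n z hz
    refine (norm_zetaTerm_le_of_re n hz.1.le).trans ?_
    have hz2 : ‖z‖ ≤ ‖s‖ + 1 := (mem_ball_zero_iff.1 hz.2).le
    have : ‖z - 1‖ ≤ ‖s‖ + 2 := (norm_sub_le _ _).trans (by rw [norm_one]; linarith)
    gcongr
  exact ((h.differentiableAt (hUo.mem_nhds hsU)).const_add 1)

theorem zetaMulSub_eq {s : ℂ} (hs : 1 < s.re) : zetaMulSub s = (s - 1) * riemannZeta s := by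
  have hz := zeta_eq_tsum_one_div_nat_add_one_cpow hs
  have hsum : Summable fun n : ℕ => (s - 1) * (1 / (n + 1 : ℂ) ^ s) := by
    refine Summable.mul_left _ ?_
    have := (summable_nat_add_iff 1).2 (Complex.summable_one_div_nat_cpow.2 hs)
    simpa using this
  set f : ℕ → ℂ := fun n => ((n + 1 : ℝ) : ℂ) ^ (1 - s) with hf
  have hterm : ∀ n, zetaTerm n s = (s - 1) * (1 / (n + 1 : ℂ) ^ s) + (f (n + 1) - f n) := by
    intro n
    simp only [zetaTerm, hf, one_div, Complex.cpow_neg]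
    push_cast
    ring_nf
  have hsum2 : Summable fun n => f (n + 1) - f n := by
    have := (summable_zetaTerm (s := s) (by linarith)).sub hsum
    refine this.congr fun n => ?_
    rw [hterm]; ring
  have hlim : Filter.Tendsto f Filter.atTop (nhds 0) := by
    rw [tendsto_zero_iff_norm_tendsto_zero]
    have : ∀ n, ‖f n‖ = (n + 1 : ℝ) ^ (-(s.re - 1)) := fun n => by
      rw [hf, Complex.norm_cpow_eq_rpow_re_of_pos (by positivity)]
      simp
    simp_rw [this]
    have h1 := (tendsto_rpow_neg_atTop (by linarith : 0 < s.re - 1)).comp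
      (tendsto_natCast_atTop_atTop (R := ℝ) |>.comp (Filter.tendsto_add_atTop_nat 1))
    refine h1.congr fun n => by simp
  -- The telescoping sum is `-f 0 = -1`, which cancels the `1` in the definition of `zetaMulSub`.
  have htel : ∑' n, (f (n + 1) - f n) = -1 := by
    refine tendsto_nhds_unique hsum2.hasSum.tendsto_sum_nat ?_
    simp_rw [Finset.sum_range_sub]
    have := hlim.sub_const (f 0)
    simpa [hf] using this
  rw [zetaMulSub, tsum_congr hterm, hsum.tsum_add hsum2, htel, tsum_mul_left, ← hz]
  ring

/-- Polynomial growth of `(s - 1) ζ(s)` in a strip slightly wider than `1 ≤ Re s ≤ 2`. -/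
theorem exists_norm_zetaMulSub_le :
    ∃ C : ℝ, 0 < C ∧ ∀ s : ℂ, 99 / 100 ≤ s.re → s.re ≤ 3 →
      ‖zetaMulSub s‖ ≤ C * (2 + |s.im|) ^ (51 / 50 : ℝ) := by
  set S := ∑' n : ℕ, 1 / (n + 1 : ℝ) ^ (101 / 100 : ℝ) with hS
  have hsum := summable_one_div_add_one_rpow (p := 101 / 100) (by norm_num)
  have hS0 : 0 ≤ S := tsum_nonneg fun n => by positivity
  refine ⟨1 + 8 * S, by positivity, fun s hs hs3 => ?_⟩
  set Q := 2 + |s.im| with hQ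
  have hQ1 : 1 ≤ Q := by rw [hQ]; linarith [abs_nonneg s.im]
  have h1 : ‖∑' n, zetaTerm n s‖ ≤ 2 * ‖s - 1‖ * ‖s‖ ^ (1 / 50 : ℝ) * S := by
    rw [hS, ← tsum_mul_left]
    exact tsum_of_norm_bounded (hsum.mul_left _).hasSum fun n => norm_zetaTerm_le_of_re n hs
  have h2 : ‖s - 1‖ ≤ Q := by
    refine (Complex.norm_le_abs_re_add_abs_im _).trans ?_
    have : |(s - 1).re| ≤ 2 := by
      simp only [Complex.sub_re, Complex.one_re, abs_le]; constructor <;> linarith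
    simpa [hQ] using this
  have h3 : ‖s‖ ≤ 2 * Q := by
    refine (Complex.norm_le_abs_re_add_abs_im _).trans ?_
    rw [abs_of_pos (by linarith)]
    rw [hQ]; linarith [abs_nonneg s.im]
  have h4 : ‖s‖ ^ (1 / 50 : ℝ) ≤ 4 * Q ^ (1 / 50 : ℝ) := by
    calc ‖s‖ ^ (1 / 50 : ℝ) ≤ (2 * Q) ^ (1 / 50 : ℝ) := by gcongr
      _ = 2 ^ (1 / 50 : ℝ) * Q ^ (1 / 50 : ℝ) := Real.mul_rpow (by norm_num) (by linarith)
      _ ≤ 4 * Q ^ (1 / 50 : ℝ) := by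
        gcongr
        calc (2 : ℝ) ^ (1 / 50 : ℝ) ≤ 2 ^ (1 : ℝ) :=
              Real.rpow_le_rpow_of_exponent_le (by norm_num) (by norm_num)
          _ ≤ 4 := by norm_num
  have h5 : Q ^ (51 / 50 : ℝ) = Q * Q ^ (1 / 50 : ℝ) := by
    rw [show (51 / 50 : ℝ) = 1 + 1 / 50 by norm_num, Real.rpow_add (by linarith), Real.rpow_one]
  have h6 : 1 ≤ Q ^ (51 / 50 : ℝ) := Real.one_le_rpow hQ1 (by norm_num)
  calc ‖zetaMulSub s‖ ≤ 1 + 2 * ‖s - 1‖ * ‖s‖ ^ (1 / 50 : ℝ) * S := by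
        refine (norm_add_le _ _).trans ?_
        rw [norm_one]; gcongr
    _ ≤ 1 + 2 * Q * (4 * Q ^ (1 / 50 : ℝ)) * S := by gcongr
    _ = 1 + 8 * S * Q ^ (51 / 50 : ℝ) := by rw [h5]; ring
    _ ≤ Q ^ (51 / 50 : ℝ) + 8 * S * Q ^ (51 / 50 : ℝ) := by gcongr
    _ = _ := by ring

/-- Cauchy's estimate on circles of radius `1/200`, which stay inside `Re s ≥ 99/100`. Three
derivatives are needed because the second derivative of `H'/H` involves `H'''`. -/
theorem exists_norm_iteratedDeriv_zetaMulSub_le :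
    ∃ C : ℝ, 0 < C ∧ ∀ j ≤ 3, ∀ s : ℂ, 1 ≤ s.re → s.re ≤ 2 →
      ‖iteratedDeriv j zetaMulSub s‖ ≤ C * (2 + |s.im|) ^ (51 / 50 : ℝ) := by
  obtain ⟨C, hC, h⟩ := exists_norm_zetaMulSub_le
  refine ⟨6 * (C * 4) * 200 ^ 3, by positivity, fun j hj s h1 h2 => ?_⟩
  set Q := 2 + |s.im| with hQ
  have hQ1 : 1 ≤ Q := by rw [hQ]; linarith [abs_nonneg s.im]
  have hin : ∀ z ∈ Metric.closedBall s (1 / 200), |z.re - s.re| ≤ 1 / 200 ∧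
      |z.im - s.im| ≤ 1 / 200 := by
    intro z hz
    rw [mem_closedBall_iff_norm] at hz
    exact ⟨(Complex.abs_re_le_norm (z - s)).trans hz, (Complex.abs_im_le_norm (z - s)).trans hz⟩
  have hd : DiffContOnCl ℂ zetaMulSub (Metric.ball s (1 / 200)) := by
    refine DifferentiableOn.diffContOnCl ?_
    rw [closure_ball _ (by norm_num)]
    intro z hz
    have := abs_le.1 (hin z hz).1
    exact (differentiableAt_zetaMulSub (by linarith)).differentiableWithinAt
  have hb : ∀ z ∈ Metric.sphere s (1 / 200), ‖zetaMulSub z‖ ≤ C * 4 * Q ^ (51 / 50 : ℝ) := by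
    intro z hz
    obtain ⟨ha, hb⟩ := hin z (Metric.sphere_subset_closedBall hz)
    rw [abs_le] at ha
    refine (h z (by linarith) (by linarith)).trans ?_
    have h3 : 2 + |z.im| ≤ 2 * Q := by
      have := abs_sub_abs_le_abs_sub z.im s.im
      rw [hQ]; linarith [abs_nonneg s.im]
    have h4 : (2 + |z.im|) ^ (51 / 50 : ℝ) ≤ 4 * Q ^ (51 / 50 : ℝ) := by
      calc (2 + |z.im|) ^ (51 / 50 : ℝ) ≤ (2 * Q) ^ (51 / 50 : ℝ) := by gcongr
        _ = 2 ^ (51 / 50 : ℝ) * Q ^ (51 / 50 : ℝ) := Real.mul_rpow (by norm_num) (by linarith)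
        _ ≤ 4 * Q ^ (51 / 50 : ℝ) := by
          gcongr
          calc (2 : ℝ) ^ (51 / 50 : ℝ) ≤ 2 ^ (2 : ℝ) :=
                Real.rpow_le_rpow_of_exponent_le (by norm_num) (by norm_num)
            _ ≤ 4 := by norm_num
    calc C * (2 + |z.im|) ^ (51 / 50 : ℝ) ≤ C * (4 * Q ^ (51 / 50 : ℝ)) := by gcongr
      _ = _ := by ring
  have := Complex.norm_iteratedDeriv_le_of_forall_mem_sphere_norm_le j (by norm_num) hd hb
  refine this.trans ?_
  have e : (j.factorial : ℝ) * (C * 4 * Q ^ (51 / 50 : ℝ)) / (1 / 200) ^ j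
      = j.factorial * (C * 4) * 200 ^ j * Q ^ (51 / 50 : ℝ) := by
    rw [one_div, inv_pow, div_inv_eq_mul]; ring
  rw [e]
  have hf : (j.factorial : ℝ) ≤ 6 := by
    exact_mod_cast (Nat.factorial_le hj).trans (by decide)
  have hp : (200 : ℝ) ^ j ≤ 200 ^ 3 := pow_le_pow_right₀ (by norm_num) hj
  gcongr

/-! ### Nonvanishing and lower bounds on `Re s ≥ 1`. -/

theorem zetaMulSub_one : zetaMulSub 1 = 1 := by
  simp [zetaMulSub, zetaTerm]

theorem zetaMulSub_ne_zero {s : ℂ} (hs : 1 ≤ s.re) : zetaMulSub s ≠ 0 := by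
  rcases eq_or_ne s 1 with rfl | h1
  · rw [zetaMulSub_one]; exact one_ne_zero
  -- The identity is available for `Re s > 1`; continuity along `s + x`, `x → 0+`, carries it to the
  -- line `Re s = 1`.
  have key : zetaMulSub s = (s - 1) * riemannZeta s := by
    have hγ : Filter.Tendsto (fun x : ℝ => s + x) (nhdsWithin 0 (Set.Ioi 0)) (nhds s) := by
      have : Filter.Tendsto (fun x : ℝ => s + x) (nhds 0) (nhds (s + (0 : ℝ))) :=
        Continuous.tendsto (by fun_prop) 0
      simp only [Complex.ofReal_zero, add_zero] at this
      exact this.mono_left nhdsWithin_le_nhds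
    have t1 := ((differentiableAt_zetaMulSub (s := s) (by linarith)).continuousAt.tendsto).comp hγ
    have t2 : Filter.Tendsto (fun z => (z - 1) * riemannZeta z) (nhds s)
        (nhds ((s - 1) * riemannZeta s)) :=
      ((continuousAt_id.sub continuousAt_const).mul
        (differentiableAt_riemannZeta h1).continuousAt).tendsto
    refine tendsto_nhds_unique t1 ((t2.comp hγ).congr' ?_)
    filter_upwards [self_mem_nhdsWithin] with x hx
    have hx : 0 < x := hx
    simp only [Function.comp_apply]
    rw [zetaMulSub_eq (by simp; linarith)]
  rw [key]
  exact mul_ne_zero (sub_ne_zero.2 h1) (riemannZeta_ne_zero_of_one_le_re hs)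

theorem one_le_norm_riemannZeta_product {x : ℝ} (hx : 0 < x) (y : ℝ) :
    1 ≤ ‖riemannZeta (1 + x)‖ ^ 3 * ‖riemannZeta (1 + x + Complex.I * y)‖ ^ 4 *
      ‖riemannZeta (1 + x + 2 * Complex.I * y)‖ := by
  have h := DirichletCharacter.norm_LFunction_product_ge_one (1 : DirichletCharacter ℂ 1) hx y
  rw [DirichletCharacter.LFunctionTrivChar] at h
  simp only [DirichletCharacter.LFunction_modOne_eq, norm_mul, norm_pow] at h
  exact h

/-- The 3-4-1 inequality multiplied by `x³ Q⁵`, where `x = Re s - 1` and `Q = 2 + |Im s|`. The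
factor at `1 + x` is `O(1/x)`, and the one at height `2 Im s` is `O(Q ^ (1/50))`, so `5 - 51/50 = 4
- 1/50` powers of `Q` remain. -/
theorem exists_pow_four_norm_zetaMulSub_ge :
    ∃ c : ℝ, 0 < c ∧ ∀ s : ℂ, 1 < s.re → s.re ≤ 2 → 1 ≤ |s.im| →
      c * (s.re - 1) ^ 3 * (2 + |s.im|) ^ (4 - 1 / 50 : ℝ) ≤ ‖zetaMulSub s‖ ^ 4 := by
  obtain ⟨C, hC, hb⟩ := exists_norm_zetaMulSub_le
  refine ⟨1 / ((4 * C) ^ 3 * 81 * (6 * C)), by positivity, fun s h1 h2 ht => ?_⟩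
  set Q := 2 + |s.im| with hQ
  have hQ3 : Q ≤ 3 * |s.im| := by rw [hQ]; linarith
  have hQ0 : 0 < Q := by linarith
  set x := s.re - 1 with hx
  have hx0 : 0 < x := by linarith
  have h341 := one_le_norm_riemannZeta_product hx0 s.im
  have e1 : (1 + x : ℂ) + Complex.I * s.im = s := by
    apply Complex.ext <;> simp [hx]
  set w : ℂ := 1 + x + 2 * Complex.I * s.im with hw
  have hwre : w.re = s.re := by simp [hw, hx]
  have hwim : w.im = 2 * s.im := by simp [hw]
  set v : ℂ := 1 + x with hv
  have hvre : v.re = s.re := by simp [hv, hx]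
  have hvim : v.im = 0 := by simp [hv]
  rw [e1] at h341
  have n1 : ‖riemannZeta v‖ * x ≤ 4 * C := by
    have h := hb v (by rw [hvre]; linarith) (by rw [hvre]; linarith)
    rw [zetaMulSub_eq (by rw [hvre]; exact h1), hvim, norm_mul] at h
    have e : ‖v - 1‖ = x := by
      rw [hv, add_sub_cancel_left, Complex.norm_of_nonneg hx0.le]
    rw [e] at h
    have : (2 + |(0 : ℝ)|) ^ (51 / 50 : ℝ) ≤ 4 := by
      rw [abs_zero, add_zero]
      calc (2 : ℝ) ^ (51 / 50 : ℝ) ≤ 2 ^ (2 : ℝ) :=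
            Real.rpow_le_rpow_of_exponent_le (by norm_num) (by norm_num)
        _ ≤ 4 := by norm_num
    calc ‖riemannZeta v‖ * x = x * ‖riemannZeta v‖ := mul_comm _ _
      _ ≤ _ := h
      _ ≤ C * 4 := by gcongr
      _ = _ := by ring
  have n2 : ‖riemannZeta s‖ * Q ≤ 3 * ‖zetaMulSub s‖ := by
    rw [zetaMulSub_eq h1, norm_mul]
    have : |s.im| ≤ ‖s - 1‖ := by simpa using Complex.abs_im_le_norm (s - 1)
    calc ‖riemannZeta s‖ * Q ≤ ‖riemannZeta s‖ * (3 * ‖s - 1‖) := by gcongr; linarith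
      _ = _ := by ring
  have n3 : ‖riemannZeta w‖ * Q ≤ 6 * C * Q ^ (51 / 50 : ℝ) := by
    have h := hb w (by rw [hwre]; linarith) (by rw [hwre]; linarith)
    rw [zetaMulSub_eq (by rw [hwre]; exact h1), hwim, norm_mul] at h
    have h5 : 2 * |s.im| ≤ ‖w - 1‖ := by
      have := Complex.abs_im_le_norm (w - 1)
      simpa [hwim, abs_mul] using this
    have h6 : (2 + |2 * s.im|) ^ (51 / 50 : ℝ) ≤ 4 * Q ^ (51 / 50 : ℝ) := by
      calc (2 + |2 * s.im|) ^ (51 / 50 : ℝ) ≤ (2 * Q) ^ (51 / 50 : ℝ) := by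
            rw [abs_mul, abs_two, hQ]; gcongr; linarith
        _ = 2 ^ (51 / 50 : ℝ) * Q ^ (51 / 50 : ℝ) := Real.mul_rpow (by norm_num) (by linarith)
        _ ≤ 4 * Q ^ (51 / 50 : ℝ) := by
          gcongr
          calc (2 : ℝ) ^ (51 / 50 : ℝ) ≤ 2 ^ (2 : ℝ) :=
                Real.rpow_le_rpow_of_exponent_le (by norm_num) (by norm_num)
            _ ≤ 4 := by norm_num
    calc ‖riemannZeta w‖ * Q ≤ ‖riemannZeta w‖ * (3 / 2 * ‖w - 1‖) := by gcongr; linarith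
      _ = 3 / 2 * (‖w - 1‖ * ‖riemannZeta w‖) := by ring
      _ ≤ 3 / 2 * (C * (4 * Q ^ (51 / 50 : ℝ))) := by
          gcongr 3 / 2 * ?_; exact h.trans (by gcongr)
      _ = _ := by ring
  have m1 : x ^ 3 * Q ^ 5 ≤
      (4 * C) ^ 3 * (3 * ‖zetaMulSub s‖) ^ 4 * (6 * C * Q ^ (51 / 50 : ℝ)) := by
    calc x ^ 3 * Q ^ 5 = 1 * (x ^ 3 * Q ^ 5) := by ring
      _ ≤ (‖riemannZeta v‖ ^ 3 * ‖riemannZeta s‖ ^ 4 * ‖riemannZeta w‖) * (x ^ 3 * Q ^ 5) := by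
        gcongr
      _ = (‖riemannZeta v‖ * x) ^ 3 * (‖riemannZeta s‖ * Q) ^ 4 * (‖riemannZeta w‖ * Q) := by ring
      _ ≤ _ := by gcongr
  have e5 : Q ^ 5 = Q ^ (4 - 1 / 50 : ℝ) * Q ^ (51 / 50 : ℝ) := by
    rw [← Real.rpow_add hQ0, ← Real.rpow_natCast]; norm_num
  have hp : 0 < Q ^ (51 / 50 : ℝ) := by positivity
  rw [e5] at m1
  have m2 : x ^ 3 * Q ^ (4 - 1 / 50 : ℝ) ≤
      (4 * C) ^ 3 * (3 * ‖zetaMulSub s‖) ^ 4 * (6 * C) := by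
    refine le_of_mul_le_mul_right ?_ hp
    calc _ = x ^ 3 * (Q ^ (4 - 1 / 50 : ℝ) * Q ^ (51 / 50 : ℝ)) := by ring
      _ ≤ _ := m1
      _ = _ := by ring
  rw [mul_assoc, one_div, inv_mul_le_iff₀ (by positivity)]
  refine m2.trans (le_of_eq ?_)
  ring

/-- Lower bound for `(s - 1) ζ(s)` on `1 < Re s ≤ 2`. -/
theorem exists_norm_zetaMulSub_ge :
    ∃ c : ℝ, 0 < c ∧ ∀ s : ℂ, 1 < s.re → s.re ≤ 2 →
      c * (2 + |s.im|) ^ (23 / 25 : ℝ) ≤ ‖zetaMulSub s‖ := by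
  obtain ⟨c₁, hc₁, h₁⟩ := exists_pow_four_norm_zetaMulSub_ge
  obtain ⟨C, hC, hD⟩ := exists_norm_iteratedDeriv_zetaMulSub_le
  -- bounded imaginary part
  obtain ⟨c₂, hc₂, h₂⟩ : ∃ c₂ : ℝ, 0 < c₂ ∧ ∀ s : ℂ, 1 < s.re → s.re ≤ 2 → |s.im| ≤ 1 →
      c₂ ≤ ‖zetaMulSub s‖ := by
    set K : Set ℂ := Set.Icc 1 2 ×ℂ Set.Icc (-1) 1 with hK
    have hKc : IsCompact K := isCompact_Icc.reProdIm isCompact_Icc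
    have hcont : ContinuousOn (fun s => ‖zetaMulSub s‖) K := fun s hs =>
      (differentiableAt_zetaMulSub (by have := hs.1.1; linarith)).continuousAt.norm.continuousWithinAt
    obtain ⟨s₀, hs₀, hmin⟩ := hKc.exists_isMinOn
      ⟨1, by simp [hK, Complex.mem_reProdIm]⟩ hcont
    refine ⟨‖zetaMulSub s₀‖, norm_pos_iff.2 (zetaMulSub_ne_zero hs₀.1.1), fun s a b d => ?_⟩
    exact hmin (show s ∈ K from ⟨⟨a.le, b⟩, abs_le.1 d⟩)
  -- Near the line the 3-4-1 bound degenerates, so it is used at `Re z = 1 + η`, `η = κ Q ^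
  -- (-1/10)`, and transported to `s` by the derivative bound. This `κ` makes the transport error
  -- `B` at most half of `‖zetaMulSub z‖`. The resulting exponent is `4 - 1/50 - 3/10 = 92/25`,
  -- whose quarter is `23/25`.
  set κ : ℝ := min 1 (c₁ / (2 * C) ^ 4) with hκ
  have hκ0 : 0 < κ := lt_min one_pos (by positivity)
  have hκ1 : κ ≤ 1 := min_le_left _ _
  have hκ2 : (2 * C) ^ 4 * κ ≤ c₁ := by
    calc (2 * C) ^ 4 * κ ≤ (2 * C) ^ 4 * (c₁ / (2 * C) ^ 4) := by
          gcongr; exact min_le_right _ _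
      _ = c₁ := by field_simp
  -- large imaginary part
  have h₃ : ∀ s : ℂ, 1 < s.re → s.re ≤ 2 → 1 ≤ |s.im| →
      c₁ * κ ^ 3 / 16 * (2 + |s.im|) ^ (92 / 25 : ℝ) ≤ ‖zetaMulSub s‖ ^ 4 := by
    intro s a b d
    set Q := 2 + |s.im| with hQ
    have hQ1 : 1 ≤ Q := by rw [hQ]; linarith
    have hQ0 : 0 < Q := by linarith
    set η := κ * Q ^ (-(1 / 10) : ℝ) with hη
    have hη0 : 0 < η := by positivity
    have hη1 : η ≤ 1 := mul_le_one₀ hκ1 (by positivity)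
      (Real.rpow_le_one_of_one_le_of_nonpos hQ1 (by norm_num))
    have eη : η ^ 3 * Q ^ (4 - 1 / 50 : ℝ) = κ ^ 3 * Q ^ (92 / 25 : ℝ) := by
      rw [hη, mul_pow, ← Real.rpow_natCast (Q ^ _), ← Real.rpow_mul hQ0.le, mul_assoc,
        ← Real.rpow_add hQ0]
      norm_num
    rcases le_total η (s.re - 1) with h | h
    · calc c₁ * κ ^ 3 / 16 * Q ^ (92 / 25 : ℝ) ≤ c₁ * (κ ^ 3 * Q ^ (92 / 25 : ℝ)) := by
            have : 0 ≤ c₁ * (κ ^ 3 * Q ^ (92 / 25 : ℝ)) := by positivity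
            linarith
        _ = c₁ * (η ^ 3 * Q ^ (4 - 1 / 50 : ℝ)) := by rw [eη]
        _ = c₁ * η ^ 3 * Q ^ (4 - 1 / 50 : ℝ) := by ring
        _ ≤ c₁ * (s.re - 1) ^ 3 * Q ^ (4 - 1 / 50 : ℝ) := by gcongr
        _ ≤ _ := h₁ s a b d
    · set z : ℂ := ⟨1 + η, s.im⟩ with hz
      have hzre : z.re = 1 + η := rfl
      have hzim : z.im = s.im := rfl
      have hA := h₁ z (by rw [hzre]; linarith) (by rw [hzre]; linarith) (by rw [hzim]; exact d)
      rw [hzre, hzim, ← hQ, add_sub_cancel_left] at hA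
      set A := ‖zetaMulSub z‖ with hAdef
      have hdiff : ‖zetaMulSub z - zetaMulSub s‖ ≤ C * Q ^ (51 / 50 : ℝ) * η := by
        set T : Set ℂ := {w | 1 ≤ w.re ∧ w.re ≤ 2 ∧ w.im = s.im} with hT
        have hTc : Convex ℝ T := by
          have e : T = (Complex.reLm ⁻¹' Set.Icc 1 2) ∩ (Complex.imLm ⁻¹' {s.im}) := by
            ext w; simp [hT, and_assoc]
          rw [e]
          exact ((convex_Icc _ _).linear_preimage _).inter ((convex_singleton _).linear_preimage _)
        have hmv := hTc.norm_image_sub_le_of_norm_deriv_le (𝕜 := ℂ) (f := zetaMulSub)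
          (C := C * Q ^ (51 / 50 : ℝ)) (x := s) (y := z)
          (fun w hw => differentiableAt_zetaMulSub (by have := hw.1; linarith))
          (fun w hw => by
            have := hD 1 (by norm_num) w hw.1 hw.2.1
            rwa [iteratedDeriv_one, hw.2.2] at this)
          ⟨a.le, b, rfl⟩ ⟨by rw [hzre]; linarith, by rw [hzre]; linarith, hzim⟩
        refine hmv.trans ?_
        gcongr
        refine (Complex.norm_le_abs_re_add_abs_im _).trans ?_
        rw [Complex.sub_re, Complex.sub_im, hzre, hzim, sub_self, abs_zero, add_zero, abs_le]
        constructor <;> linarith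
      set B := C * Q ^ (51 / 50 : ℝ) * η with hB
      have hBA : 2 * B ≤ A := by
        refine le_of_pow_le_pow_left₀ (n := 4) (by norm_num) (norm_nonneg _) ?_
        refine le_trans ?_ hA
        have e2 : (Q ^ (51 / 50 : ℝ)) ^ 4 * η = κ * Q ^ (4 - 1 / 50 : ℝ) := by
          rw [hη, ← Real.rpow_natCast (Q ^ _), ← Real.rpow_mul hQ0.le, mul_left_comm,
            ← Real.rpow_add hQ0]
          norm_num
        calc (2 * B) ^ 4 = (2 * C) ^ 4 * η ^ 3 * ((Q ^ (51 / 50 : ℝ)) ^ 4 * η) := by rw [hB]; ring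
          _ = ((2 * C) ^ 4 * κ) * η ^ 3 * Q ^ (4 - 1 / 50 : ℝ) := by rw [e2]; ring
          _ ≤ c₁ * η ^ 3 * Q ^ (4 - 1 / 50 : ℝ) := by gcongr
      have hge : A / 2 ≤ ‖zetaMulSub s‖ := by
        have := norm_sub_norm_le (zetaMulSub z) (zetaMulSub s)
        linarith
      calc c₁ * κ ^ 3 / 16 * Q ^ (92 / 25 : ℝ) = c₁ * (κ ^ 3 * Q ^ (92 / 25 : ℝ)) / 16 := by ring
        _ = c₁ * η ^ 3 * Q ^ (4 - 1 / 50 : ℝ) / 16 := by rw [← eη]; ring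
        _ ≤ A ^ 4 / 16 := by gcongr
        _ = (A / 2) ^ 4 := by ring
        _ ≤ _ := by gcongr
  set c₃ := (c₁ * κ ^ 3 / 16) ^ (1 / 4 : ℝ) with hc₃
  have hc₃0 : 0 < c₃ := by positivity
  have hc₃4 : c₃ ^ 4 = c₁ * κ ^ 3 / 16 := by
    rw [hc₃, ← Real.rpow_natCast, ← Real.rpow_mul (by positivity)]; norm_num
  refine ⟨min c₃ (c₂ / 3), lt_min hc₃0 (by positivity), fun s a b => ?_⟩
  rcases le_total 1 |s.im| with d | d
  · refine le_of_pow_le_pow_left₀ (n := 4) (by norm_num) (norm_nonneg _) ?_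
    refine le_trans ?_ (h₃ s a b d)
    have e : ((2 + |s.im|) ^ (23 / 25 : ℝ)) ^ 4 = (2 + |s.im|) ^ (92 / 25 : ℝ) := by
      rw [← Real.rpow_natCast, ← Real.rpow_mul (by positivity)]; norm_num
    rw [mul_pow, e, ← hc₃4]
    gcongr
    exact min_le_left _ _
  · refine le_trans ?_ (h₂ s a b d)
    have : (2 + |s.im|) ^ (23 / 25 : ℝ) ≤ 3 := by
      calc (2 + |s.im|) ^ (23 / 25 : ℝ) ≤ (2 + |s.im|) ^ (1 : ℝ) :=
            Real.rpow_le_rpow_of_exponent_le (by linarith [abs_nonneg s.im]) (by norm_num)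
        _ ≤ 3 := by rw [Real.rpow_one]; linarith
    calc min c₃ (c₂ / 3) * (2 + |s.im|) ^ (23 / 25 : ℝ) ≤ c₂ / 3 * 3 := by
          gcongr; exact min_le_right _ _
      _ = c₂ := by ring

/-! ### The Laplace transform of `ψ(eᵘ) - eᵘ` and its second derivative. -/

theorem differentiableAt_iteratedDeriv_zetaMulSub (j : ℕ) {s : ℂ} (hs : 99 / 100 < s.re) :
    DifferentiableAt ℂ (iteratedDeriv j zetaMulSub) s := by
  have hU : IsOpen {z : ℂ | 99 / 100 < z.re} :=
    isOpen_lt continuous_const Complex.continuous_re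
  have han : AnalyticOnNhd ℂ zetaMulSub {z : ℂ | 99 / 100 < z.re} :=
    DifferentiableOn.analyticOnNhd
      (fun z hz => (differentiableAt_zetaMulSub hz).differentiableWithinAt) hU
  rw [iteratedDeriv_eq_iterate]
  exact (han.iterated_deriv j s hs).differentiableAt

theorem hasDerivAt_iteratedDeriv_zetaMulSub (j : ℕ) {s : ℂ} (hs : 1 < s.re) :
    HasDerivAt (iteratedDeriv j zetaMulSub) (iteratedDeriv (j + 1) zetaMulSub s) s := by
  rw [iteratedDeriv_succ]
  exact (differentiableAt_iteratedDeriv_zetaMulSub j (by linarith)).hasDerivAt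

/-- The Laplace transform of `ψ(eᵘ) - eᵘ`. -/
noncomputable def psiLaplace (s : ℂ) : ℂ :=
  -deriv riemannZeta s / riemannZeta s / s - 1 / (s - 1)

/-- The pole at `s = 1` cancels: `-ζ'/ζ = 1/(s - 1) - H'/H` with `H = zetaMulSub`, and `1/(s(s - 1))
- 1/(s - 1) = -1/s`. -/
theorem psiLaplace_eq {s : ℂ} (hs : 1 < s.re) :
    psiLaplace s = -(1 + iteratedDeriv 1 zetaMulSub s / iteratedDeriv 0 zetaMulSub s) / s := by
  have h1 : s - 1 ≠ 0 := sub_ne_zero.2 (by rintro rfl; simp at hs)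
  have h0 : s ≠ 0 := by rintro rfl; simp at hs; linarith
  have hz : riemannZeta s ≠ 0 := riemannZeta_ne_zero_of_one_le_re hs.le
  have hev : zetaMulSub =ᶠ[nhds s] fun z => (z - 1) * riemannZeta z := by
    filter_upwards [(isOpen_lt continuous_const Complex.continuous_re).mem_nhds hs] with z hz
    exact zetaMulSub_eq hz
  have hd : deriv zetaMulSub s = riemannZeta s + (s - 1) * deriv riemannZeta s := by
    rw [hev.deriv_eq]
    have := ((hasDerivAt_id s).sub_const 1).mul
      (differentiableAt_riemannZeta (sub_ne_zero.1 h1)).hasDerivAt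
    rw [one_mul] at this
    exact this.deriv
  rw [iteratedDeriv_one, iteratedDeriv_zero, hd, zetaMulSub_eq hs, psiLaplace]
  field_simp
  ring

/-- Each quotient `q j = H⁽ʲ⁾/H` grows at most like `Q ^ (51/50 - 23/25) = Q ^ (1/10)`. The second
derivative of `-(1 + q 1)/s` contains products of at most three of them over a power of `s`, hence
`3/10 - 1 = -7/10`. What matters later is that this is below `-1/2`. -/
theorem exists_psiLaplace_derivatives :
    ∃ F₁ F₂ : ℂ → ℂ, ∃ C : ℝ, 0 < C ∧ (∀ s, 1 < s.re → HasDerivAt psiLaplace (F₁ s) s) ∧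
      (∀ s, 1 < s.re → HasDerivAt F₁ (F₂ s) s) ∧
      ∀ s, 1 < s.re → s.re ≤ 2 → ‖F₂ s‖ ≤ C * (2 + |s.im|) ^ (-(7 / 10) : ℝ) := by
  set H : ℕ → ℂ → ℂ := fun j => iteratedDeriv j zetaMulSub with hH
  have hHd : ∀ j s, 1 < s.re → HasDerivAt (H j) (H (j + 1) s) s := fun j s hs =>
    hasDerivAt_iteratedDeriv_zetaMulSub j hs
  have hH0 : ∀ s, 1 < s.re → H 0 s ≠ 0 := fun s hs => by
    simpa [hH] using zetaMulSub_ne_zero hs.le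
  set q : ℕ → ℂ → ℂ := fun j s => H j s / H 0 s with hq
  have hqd : ∀ j s, 1 < s.re → HasDerivAt (q j) (q (j + 1) s - q j s * q 1 s) s := by
    intro j s hs
    have h := (hHd j s hs).div (hHd 0 s hs) (hH0 s hs)
    refine h.congr_deriv ?_
    simp only [hq]
    have := hH0 s hs
    field_simp
  set G : ℂ → ℂ := fun s => -(1 + q 1 s) / s with hG
  set L₁ : ℂ → ℂ := fun s => q 2 s - q 1 s * q 1 s with hL₁
  set L₂ : ℂ → ℂ := fun s => q 3 s - q 2 s * q 1 s - 2 * q 1 s * L₁ s with hL₂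
  have hs0 : ∀ s : ℂ, 1 < s.re → s ≠ 0 := fun s hs => by rintro rfl; simp at hs; linarith
  have hL₁d : ∀ s, 1 < s.re → HasDerivAt L₁ (L₂ s) s := by
    intro s hs
    have h := (hqd 2 s hs).sub ((hqd 1 s hs).mul (hqd 1 s hs))
    refine h.congr_deriv ?_
    simp only [hL₂, hL₁]
    ring
  refine ⟨fun s => (1 + q 1 s) / s ^ 2 - L₁ s / s,
    fun s => -2 * (1 + q 1 s) / s ^ 3 + 2 * L₁ s / s ^ 2 - L₂ s / s, ?_⟩
  obtain ⟨C, hC, hD⟩ := exists_norm_iteratedDeriv_zetaMulSub_le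
  obtain ⟨c, hc, hl⟩ := exists_norm_zetaMulSub_ge
  set M := max 1 (C / c) with hM
  have hM1 : 1 ≤ M := le_max_left _ _
  refine ⟨54 * M ^ 3, by positivity, ?_, ?_, ?_⟩
  · intro s hs
    have h := (((hqd 1 s hs).const_add 1).neg).div (hasDerivAt_id s) (hs0 s hs)
    have hev : psiLaplace =ᶠ[nhds s] G := by
      filter_upwards [(isOpen_lt continuous_const Complex.continuous_re).mem_nhds hs] with z hz
      rw [psiLaplace_eq hz]
    refine HasDerivAt.congr_of_eventuallyEq ?_ hev
    refine h.congr_deriv ?_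
    simp only [hL₁, id]
    have := hs0 s hs
    field_simp
    simp
    ring
  · intro s hs
    have h := (((hqd 1 s hs).const_add 1).div ((hasDerivAt_id s).pow 2)
      (pow_ne_zero 2 (hs0 s hs))).sub ((hL₁d s hs).div (hasDerivAt_id s) (hs0 s hs))
    refine h.congr_deriv ?_
    simp only [hL₁, id]
    have := hs0 s hs
    simp
    field_simp
    ring
  · intro s h1 h2
    set Q := 2 + |s.im| with hQ
    have hQ1 : 1 ≤ Q := by rw [hQ]; linarith [abs_nonneg s.im]
    have hQ0 : 0 < Q := by linarith
    set W := M * Q ^ (1 / 10 : ℝ) with hW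
    have hW1 : 1 ≤ W := one_le_mul_of_one_le_of_one_le hM1 (Real.one_le_rpow hQ1 (by norm_num))
    have hqb : ∀ j ≤ 3, ‖q j s‖ ≤ W := by
      intro j hj
      simp only [hq]
      have hpos : 0 < c * Q ^ (23 / 25 : ℝ) := by positivity
      have hlow := hl s h1 h2
      rw [norm_div, div_le_iff₀ (hpos.trans_le (by simpa [hH] using hlow))]
      calc ‖H j s‖ ≤ C * Q ^ (51 / 50 : ℝ) := hD j hj s h1.le h2
        _ = (C / c) * Q ^ (1 / 10 : ℝ) * (c * Q ^ (23 / 25 : ℝ)) := by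
          rw [show (51 / 50 : ℝ) = 1 / 10 + 23 / 25 by norm_num, Real.rpow_add hQ0]
          field_simp
        _ ≤ W * ‖H 0 s‖ := by
          have := hl s h1 h2
          simp only [hH, iteratedDeriv_zero]
          gcongr
          · rw [hW]; gcongr; exact le_max_right _ _
    have b1 := hqb 1 (by norm_num)
    have b2 := hqb 2 (by norm_num)
    have b3 := hqb 3 (by norm_num)
    have hW2 : W ≤ W ^ 2 := by nlinarith
    have hW3 : W ^ 2 ≤ W ^ 3 := by nlinarith
    have a0 : ‖1 + q 1 s‖ ≤ 2 * W ^ 3 :=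
      (norm_add_le _ _).trans (by rw [norm_one]; linarith)
    have a1 : ‖L₁ s‖ ≤ 2 * W ^ 2 := by
      refine (norm_sub_le _ _).trans ?_
      rw [norm_mul]
      have : ‖q 1 s‖ * ‖q 1 s‖ ≤ W * W := by gcongr
      nlinarith
    have a2 : ‖L₂ s‖ ≤ 6 * W ^ 3 := by
      refine (norm_sub_le _ _).trans ?_
      have i1 : ‖q 3 s - q 2 s * q 1 s‖ ≤ W ^ 3 + W ^ 3 := by
        refine (norm_sub_le _ _).trans ?_
        rw [norm_mul]
        have : ‖q 2 s‖ * ‖q 1 s‖ ≤ W * W := by gcongr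
        nlinarith
      have i2 : ‖2 * q 1 s * L₁ s‖ ≤ 4 * W ^ 3 := by
        rw [norm_mul, norm_mul]
        calc ‖(2 : ℂ)‖ * ‖q 1 s‖ * ‖L₁ s‖ ≤ 2 * W * (2 * W ^ 2) := by
              rw [Complex.norm_ofNat]; gcongr
          _ = _ := by ring
      linarith
    have hsn : 1 ≤ ‖s‖ := by
      have := Complex.abs_re_le_norm s
      rw [abs_of_pos (by linarith)] at this
      linarith
    have hsQ : Q ≤ 3 * ‖s‖ := by
      have := Complex.abs_im_le_norm s
      rw [hQ]; linarith
    have hs2 : ‖s‖ ≤ ‖s‖ ^ 2 := by nlinarith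
    have hs3 : ‖s‖ ≤ ‖s‖ ^ 3 := by nlinarith
    have hspos : 0 < ‖s‖ := by linarith
    have t1 : ‖-2 * (1 + q 1 s) / s ^ 3‖ ≤ 4 * W ^ 3 / ‖s‖ := by
      rw [norm_div, norm_mul, norm_neg, Complex.norm_ofNat, norm_pow]
      have : 2 * ‖1 + q 1 s‖ ≤ 4 * W ^ 3 := by linarith
      gcongr
    have t2 : ‖2 * L₁ s / s ^ 2‖ ≤ 4 * W ^ 3 / ‖s‖ := by
      rw [norm_div, norm_mul, Complex.norm_ofNat, norm_pow]
      have : 2 * ‖L₁ s‖ ≤ 4 * W ^ 3 := by linarith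
      gcongr
    have t3 : ‖L₂ s / s‖ ≤ 6 * W ^ 3 / ‖s‖ := by
      rw [norm_div]; gcongr
    calc ‖-2 * (1 + q 1 s) / s ^ 3 + 2 * L₁ s / s ^ 2 - L₂ s / s‖
        ≤ 4 * W ^ 3 / ‖s‖ + 4 * W ^ 3 / ‖s‖ + 6 * W ^ 3 / ‖s‖ :=
          (norm_sub_le _ _).trans (add_le_add ((norm_add_le _ _).trans (add_le_add t1 t2)) t3)
      _ = 14 * W ^ 3 / ‖s‖ := by ring
      _ ≤ 18 * W ^ 3 / (Q / 3) := by
        gcongr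
        · norm_num
        · linarith
      _ = 54 * M ^ 3 * Q ^ (-(7 / 10) : ℝ) := by
        rw [hW, mul_pow, ← Real.rpow_natCast (Q ^ _), ← Real.rpow_mul hQ0.le,
          show (-(7 / 10) : ℝ) = (1 / 10) * (3 : ℕ) - 1 by norm_num, Real.rpow_sub hQ0,
          Real.rpow_one]
        ring_nf

/-! ### Mean square of the damped error term. -/

open MeasureTheory in
theorem integrableOn_pow_mul_exp_neg (n : ℕ) {b : ℝ} (hb : 0 < b) :
    IntegrableOn (fun u : ℝ => u ^ n * Real.exp (-b * u)) (Set.Ioi 0) := by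
  have h := integrableOn_rpow_mul_exp_neg_mul_rpow (p := 1) (s := n) (b := b)
    (by linarith [(Nat.cast_nonneg n : (0 : ℝ) ≤ n)]) one_pos hb
  simpa using h

theorem abs_psi_sub_le {x : ℝ} (hx : 0 ≤ x) : |Chebyshev.psi x - x| ≤ 6 * x := by
  have h1 := Chebyshev.psi_le_const_mul_self hx
  have h2 := Chebyshev.psi_nonneg x
  have h3 : Real.log 4 ≤ 2 := by
    have : Real.log 4 = 2 * Real.log 2 := by
      rw [show (4 : ℝ) = 2 ^ 2 by norm_num, Real.log_pow]; norm_num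
    rw [this]; linarith [Real.log_two_lt_d9]
  rw [abs_le]
  constructor <;> nlinarith

/-- The function `(ψ(eᵘ) - eᵘ) e^{-σu}`, extended by zero to `u ≤ 0`. -/
noncomputable def psiDamped (σ : ℝ) : ℝ → ℂ :=
  (Set.Ioi 0).indicator fun u =>
    (((Chebyshev.psi (Real.exp u) - Real.exp u) * Real.exp (-σ * u) : ℝ) : ℂ)

theorem measurable_psiDamped (σ : ℝ) : Measurable (psiDamped σ) := by
  have h1 : Measurable Chebyshev.psi := Chebyshev.psi_mono.measurable
  refine Measurable.indicator ?_ measurableSet_Ioi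
  exact Complex.measurable_ofReal.comp
    (((h1.comp Real.measurable_exp).sub Real.measurable_exp).mul (by fun_prop))

theorem norm_psiDamped_le (σ u : ℝ) :
    ‖psiDamped σ u‖ ≤ (Set.Ioi 0).indicator (fun u => 6 * Real.exp (-(σ - 1) * u)) u := by
  rw [psiDamped, Set.indicator_apply, Set.indicator_apply]
  split_ifs with h
  · rw [Complex.norm_real, Real.norm_eq_abs, abs_mul, abs_of_pos (Real.exp_pos (-σ * u))]
    calc _ ≤ 6 * Real.exp u * Real.exp (-σ * u) := by
          gcongr; exact abs_psi_sub_le (Real.exp_pos u).le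
      _ = _ := by rw [mul_assoc, ← Real.exp_add]; ring_nf
  · simp

open MeasureTheory in
theorem integrable_pow_mul_psiDamped (n : ℕ) {σ : ℝ} (hσ : 1 < σ) :
    Integrable fun u : ℝ => (u : ℂ) ^ n * psiDamped σ u := by
  have h := ((integrableOn_pow_mul_exp_neg n (sub_pos.2 hσ)).const_mul 6)
  replace h := (integrable_indicator_iff measurableSet_Ioi).2 h
  refine h.mono' (((Complex.measurable_ofReal.pow_const n).mul
    (measurable_psiDamped σ)).aestronglyMeasurable) (Filter.Eventually.of_forall fun u => ?_)
  have hb := norm_psiDamped_le σ u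
  rw [norm_mul, norm_pow, Complex.norm_real, Real.norm_eq_abs]
  rw [Set.indicator_apply] at hb ⊢
  split_ifs at hb ⊢ with hu
  · rw [abs_of_pos hu]
    calc u ^ n * ‖psiDamped σ u‖ ≤ u ^ n * (6 * Real.exp (-(σ - 1) * u)) := by
          have : 0 ≤ u := le_of_lt hu
          gcongr
      _ = _ := by ring
  · have : ‖psiDamped σ u‖ = 0 := le_antisymm hb (norm_nonneg _)
    rw [this, mul_zero]

open MeasureTheory in
theorem memLp_pow_mul_psiDamped (n : ℕ) {σ : ℝ} (hσ : 1 < σ) :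
    MemLp (fun u : ℝ => (u : ℂ) ^ n * psiDamped σ u) 2 := by
  have hm := ((Complex.measurable_ofReal.pow_const n).mul
    (measurable_psiDamped σ)).aestronglyMeasurable (μ := (volume : Measure ℝ))
  refine (memLp_two_iff_integrable_sq_norm hm).2 ?_
  have h := ((integrableOn_pow_mul_exp_neg (n * 2) (b := 2 * (σ - 1))
    (by linarith)).const_mul 36)
  replace h := (integrable_indicator_iff measurableSet_Ioi).2 h
  refine h.mono' (hm.norm.pow 2) (Filter.Eventually.of_forall fun u => ?_)
  have hb := norm_psiDamped_le σ u
  simp only [Pi.mul_apply]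
  rw [norm_mul, Real.norm_eq_abs, abs_of_nonneg (by positivity), norm_pow, Complex.norm_real, Real.norm_eq_abs]
  rw [Set.indicator_apply] at hb ⊢
  split_ifs at hb ⊢ with hu
  · have hu0 : 0 < u := hu
    rw [abs_of_pos hu0]
    calc (u ^ n * ‖psiDamped σ u‖) ^ 2 ≤ (u ^ n * (6 * Real.exp (-(σ - 1) * u))) ^ 2 := by
          gcongr
      _ = 36 * (u ^ (n * 2) * Real.exp (-(2 * (σ - 1)) * u)) := by
          rw [show -(2 * (σ - 1)) * u = -(σ - 1) * u + -(σ - 1) * u by ring, Real.exp_add]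
          ring
  · have : ‖psiDamped σ u‖ = 0 := le_antisymm hb (norm_nonneg _)
    rw [this]; simp

open MeasureTheory in
theorem integral_Ioi_one_eq_integral_exp (g : ℝ → ℂ) :
    ∫ x in Set.Ioi (1 : ℝ), g x = ∫ u in Set.Ioi (0 : ℝ), (Real.exp u : ℂ) * g (Real.exp u) := by
  have himg : Real.exp '' Set.Ioi 0 = Set.Ioi 1 := by
    ext x
    simp only [Set.mem_image, Set.mem_Ioi]
    constructor
    · rintro ⟨u, hu, rfl⟩; exact Real.one_lt_exp_iff.2 hu
    · intro hx; exact ⟨Real.log x, Real.log_pos hx, Real.exp_log (by linarith)⟩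
  rw [← himg, integral_image_eq_integral_abs_deriv_smul measurableSet_Ioi
    (fun x _ => (Real.hasDerivAt_exp x).hasDerivWithinAt) Real.exp_injective.injOn]
  refine integral_congr_ae (Filter.Eventually.of_forall fun u => ?_)
  simp [abs_of_pos (Real.exp_pos u)]

theorem ofReal_exp_cpow (u : ℝ) (s : ℂ) : ((Real.exp u : ℝ) : ℂ) ^ s = Complex.exp (s * u) := by
  rw [Complex.cpow_def_of_ne_zero (by exact_mod_cast (Real.exp_pos u).ne'),
    ← Complex.ofReal_log (Real.exp_pos u).le, Real.log_exp, mul_comm]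

open MeasureTheory in
theorem integrableOn_mul_cexp_neg {g : ℝ → ℝ} (hg : Measurable g) {K : ℝ}
    (hK : ∀ u, |g u| ≤ K * Real.exp u) {s : ℂ} (hs : 1 < s.re) :
    IntegrableOn (fun u : ℝ => (g u : ℂ) * Complex.exp (-s * u)) (Set.Ioi 0) := by
  have h := (integrableOn_pow_mul_exp_neg 0 (sub_pos.2 hs)).const_mul K
  refine Integrable.mono' h ((Complex.measurable_ofReal.comp hg).mul
    (by fun_prop)).aestronglyMeasurable (Filter.Eventually.of_forall fun u => ?_)
  rw [norm_mul, Complex.norm_real, Real.norm_eq_abs, Complex.norm_exp]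
  have : (-s * u).re = -s.re * u := by simp
  rw [this]
  calc |g u| * Real.exp (-s.re * u) ≤ K * Real.exp u * Real.exp (-s.re * u) := by
        gcongr; exact hK u
    _ = _ := by rw [mul_assoc, ← Real.exp_add]; ring_nf

open MeasureTheory in
theorem integral_psi_exp_mul_cexp {s : ℂ} (hs : 1 < s.re) :
    ∫ u in Set.Ioi (0 : ℝ), (Chebyshev.psi (Real.exp u) : ℂ) * Complex.exp (-s * u) =
      -deriv riemannZeta s / riemannZeta s / s := by
  have hs0 : s ≠ 0 := by rintro rfl; simp at hs; linarith
  have hψ : ∀ x : ℝ, ∑ k ∈ Finset.Icc 1 ⌊x⌋₊, ArithmeticFunction.vonMangoldt k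
      = Chebyshev.psi x := fun x => by rw [Chebyshev.psi]; rfl
  have h := LSeries_eq_mul_integral_of_nonneg (fun n => ArithmeticFunction.vonMangoldt n)
    (r := 1) zero_le_one hs (by
      refine Asymptotics.IsBigO.of_bound (Real.log 4 + 4)
        (Filter.Eventually.of_forall fun n => ?_)
      have h1 := hψ n
      rw [Nat.floor_natCast] at h1
      rw [h1, Real.rpow_one, Real.norm_of_nonneg (Chebyshev.psi_nonneg _),
        Real.norm_of_nonneg (Nat.cast_nonneg n)]
      exact Chebyshev.psi_le_const_mul_self (Nat.cast_nonneg n))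
    (fun n => ArithmeticFunction.vonMangoldt_nonneg)
  have h2 := ArithmeticFunction.LSeries_vonMangoldt_eq_deriv_riemannZeta_div hs
  rw [← h2, h, mul_div_cancel_left₀ _ hs0, integral_Ioi_one_eq_integral_exp]
  refine integral_congr_ae (Filter.Eventually.of_forall fun u => ?_)
  simp only
  rw [← Complex.ofReal_sum, hψ, ofReal_exp_cpow, Complex.ofReal_exp, mul_left_comm,
    ← Complex.exp_add]
  ring_nf

open MeasureTheory in
theorem integral_exp_mul_cexp {s : ℂ} (hs : 1 < s.re) :
    ∫ u in Set.Ioi (0 : ℝ), (Real.exp u : ℂ) * Complex.exp (-s * u) = 1 / (s - 1) := by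
  have h := integral_Ioi_cpow_of_lt (a := -s) (by simpa using hs) one_pos
  rw [integral_Ioi_one_eq_integral_exp] at h
  simp_rw [ofReal_exp_cpow] at h
  rw [h, Complex.ofReal_one, Complex.one_cpow, neg_div, ← div_neg]
  congr 1
  ring

open MeasureTheory FourierTransform in
theorem fourier_psiDamped {σ : ℝ} (hσ : 1 < σ) (ξ : ℝ) :
    𝓕 (psiDamped σ) ξ = psiLaplace (σ + 2 * Real.pi * Complex.I * ξ) := by
  set s : ℂ := σ + 2 * Real.pi * Complex.I * ξ with hs
  have hsre : s.re = σ := by simp [hs]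
  have hs1 : 1 < s.re := by rw [hsre]; exact hσ
  have i1 : IntegrableOn (fun u : ℝ => (Chebyshev.psi (Real.exp u) : ℂ) * Complex.exp (-s * u))
      (Set.Ioi 0) :=
    integrableOn_mul_cexp_neg (K := Real.log 4 + 4)
      (Chebyshev.psi_mono.measurable.comp Real.measurable_exp) (fun u => by
        rw [Function.comp_apply, abs_of_nonneg (Chebyshev.psi_nonneg _)]
        exact Chebyshev.psi_le_const_mul_self (Real.exp_pos u).le) hs1
  have i2 : IntegrableOn (fun u : ℝ => (Real.exp u : ℂ) * Complex.exp (-s * u)) (Set.Ioi 0) :=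
    integrableOn_mul_cexp_neg (K := 1) Real.measurable_exp
      (fun u => by rw [abs_of_pos (Real.exp_pos u), one_mul]) hs1
  rw [psiLaplace, ← integral_psi_exp_mul_cexp hs1, ← integral_exp_mul_cexp hs1,
    ← integral_sub i1 i2, Real.fourier_real_eq_integral_exp_smul, ← integral_indicator
    measurableSet_Ioi]
  refine integral_congr_ae (Filter.Eventually.of_forall fun u => ?_)
  simp only [psiDamped, Set.indicator_apply]
  split_ifs with hu
  · rw [smul_eq_mul]
    push_cast
    rw [← sub_mul, mul_left_comm, ← Complex.exp_add, hs]
    congr 2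
    ring
  · simp

open MeasureTheory FourierTransform in
/-- Weighted mean square bound for the error term of the prime number theorem. -/
theorem exists_integral_sq_psi_sub_le :
    ∃ B : ℝ, 0 < B ∧ ∀ σ : ℝ, 1 < σ → σ ≤ 2 →
      ∫ u : ℝ, (u ^ 2 * ‖psiDamped σ u‖) ^ 2 ≤ B := by
  obtain ⟨F₁, F₂, C, hC, hF₁, hF₂, hb⟩ := exists_psiLaplace_derivatives
  have hint : Integrable fun x : ℝ => (1 + ‖x‖) ^ (-(7 / 5) : ℝ) :=
    integrable_one_add_norm (by simp; norm_num)
  set J := ∫ x : ℝ, (1 + ‖x‖) ^ (-(7 / 5) : ℝ) with hJ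
  have hJ0 : 0 ≤ J := integral_nonneg fun x => by positivity
  refine ⟨C ^ 2 * J + 1, by positivity, fun σ h1 h2 => ?_⟩
  set c : ℂ := 2 * Real.pi * Complex.I with hc
  have hc0 : c ≠ 0 := by simp [hc, Real.pi_ne_zero]
  set γ : ℝ → ℂ := fun ξ => σ + c * ξ with hγ
  have hγd : ∀ ξ, HasDerivAt γ c ξ := fun ξ => by
    exact (((hasDerivAt_id ξ).ofReal_comp.const_mul c).const_add (σ : ℂ)).congr_deriv (by simp)
  have hγre : ∀ ξ, (γ ξ).re = σ := fun ξ => by simp [hγ, hc]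
  have hγim : ∀ ξ, (γ ξ).im = 2 * Real.pi * ξ := fun ξ => by simp [hγ, hc]
  have e0 : 𝓕 (psiDamped σ) = fun ξ => psiLaplace (γ ξ) := funext fun ξ => fourier_psiDamped h1 ξ
  have g0 : Integrable (psiDamped σ) := by simpa using integrable_pow_mul_psiDamped 0 h1
  set f₁ : ℝ → ℂ := fun x => (-2 * Real.pi * Complex.I * x) • psiDamped σ x with hf₁
  set f₂ : ℝ → ℂ := fun x => (-2 * Real.pi * Complex.I * x) • f₁ x with hf₂
  have g1' : Integrable fun x : ℝ => x • psiDamped σ x := by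
    simpa using integrable_pow_mul_psiDamped 1 h1
  have g1 : Integrable f₁ := by
    refine ((integrable_pow_mul_psiDamped 1 h1).const_mul (-c)).congr
      (Filter.Eventually.of_forall fun x => ?_)
    simp only [hf₁, hc, smul_eq_mul]; ring
  have g2' : Integrable fun x : ℝ => x • f₁ x := by
    refine ((integrable_pow_mul_psiDamped 2 h1).const_mul (-c)).congr
      (Filter.Eventually.of_forall fun x => ?_)
    simp only [hf₁, hc, smul_eq_mul, Complex.real_smul]; ring
  -- Two multiplications by `-c x` correspond to two derivatives of the transform, so the transform
  -- of `f₂` is `c² F₂` on the vertical line; its bound does not depend on `σ`.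
  have ef₂ : f₂ = fun x : ℝ => c ^ 2 * ((x : ℂ) ^ 2 * psiDamped σ x) := by
    funext x
    simp only [hf₂, hf₁, hc, smul_eq_mul]; ring
  have g2 : Integrable f₂ := by
    rw [ef₂]; exact (integrable_pow_mul_psiDamped 2 h1).const_mul _
  have m2 : MemLp f₂ 2 := by
    rw [ef₂]; exact (memLp_pow_mul_psiDamped 2 h1).const_mul _
  have e1 : 𝓕 f₁ = fun ξ => F₁ (γ ξ) * c := by
    funext ξ
    have d1 := Real.hasDerivAt_fourier g0 g1' ξ
    have d2 : HasDerivAt (fun ξ => psiLaplace (γ ξ)) (F₁ (γ ξ) * c) ξ :=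
      HasDerivAt.comp ξ (hF₁ (γ ξ) (by rw [hγre]; exact h1)) (hγd ξ)
    rw [e0] at d1
    exact d1.unique d2
  have e2 : ∀ ξ, 𝓕 f₂ ξ = F₂ (γ ξ) * c * c := by
    intro ξ
    have d1 := Real.hasDerivAt_fourier g1 g2' ξ
    have d2 : HasDerivAt (fun ξ => F₁ (γ ξ) * c) (F₂ (γ ξ) * c * c) ξ :=
      (HasDerivAt.comp ξ (hF₂ (γ ξ) (by rw [hγre]; exact h1)) (hγd ξ)).mul_const c
    rw [e1] at d1
    exact d1.unique d2
  have hP := integral_norm_fourier_sq_eq g2 m2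
  have hcn : 0 < ‖c‖ ^ 4 := by have := norm_pos_iff.2 hc0; positivity
  have l1 : ∫ x, ‖f₂ x‖ ^ 2 = ‖c‖ ^ 4 * ∫ u : ℝ, (u ^ 2 * ‖psiDamped σ u‖) ^ 2 := by
    rw [← integral_const_mul]
    refine integral_congr_ae (Filter.Eventually.of_forall fun x => ?_)
    simp only [ef₂, norm_mul, norm_pow, Complex.norm_real, Real.norm_eq_abs, sq_abs]
    ring
  have l2 : ∫ x, ‖𝓕 f₂ x‖ ^ 2 ≤ ‖c‖ ^ 4 * (C ^ 2 * J) := by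
    rw [hJ, ← integral_const_mul, ← integral_const_mul]
    refine integral_mono_of_nonneg (Filter.Eventually.of_forall fun x => by positivity)
      ((hint.const_mul _).const_mul _) (Filter.Eventually.of_forall fun x => ?_)
    simp only
    rw [e2, norm_mul, norm_mul]
    have hbx := hb (γ x) (by rw [hγre]; exact h1) (by rw [hγre]; exact h2)
    rw [hγim] at hbx
    have hle : (2 + |2 * Real.pi * x|) ^ (-(7 / 10) : ℝ) ≤ (1 + ‖x‖) ^ (-(7 / 10) : ℝ) := by
      refine Real.rpow_le_rpow_of_nonpos (by positivity) ?_ (by norm_num)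
      rw [abs_mul, abs_of_pos Real.two_pi_pos, Real.norm_eq_abs]
      have := Real.pi_gt_three
      nlinarith [abs_nonneg x]
    have hb2 : ‖F₂ (γ x)‖ ≤ C * (1 + ‖x‖) ^ (-(7 / 10) : ℝ) := hbx.trans (by gcongr)
    have hsq : ((1 + ‖x‖) ^ (-(7 / 10) : ℝ)) ^ 2 = (1 + ‖x‖) ^ (-(7 / 5) : ℝ) := by
      rw [← Real.rpow_natCast, ← Real.rpow_mul (by positivity)]; norm_num
    calc (‖F₂ (γ x)‖ * ‖c‖ * ‖c‖) ^ 2 = ‖c‖ ^ 4 * ‖F₂ (γ x)‖ ^ 2 := by ring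
      _ ≤ ‖c‖ ^ 4 * (C * (1 + ‖x‖) ^ (-(7 / 10) : ℝ)) ^ 2 := by gcongr
      _ = _ := by rw [mul_pow, hsq]
  rw [hP, l1] at l2
  have := le_of_mul_le_mul_left l2 hcn
  linarith

/-! ### From the mean square to the prime number theorem. -/

open MeasureTheory in
theorem exists_mul_sq_le_of_le_abs_psi_sub :
    ∃ B : ℝ, 0 < B ∧ ∀ U : ℝ, 1 ≤ U → ∀ a b ρ : ℝ, U / 2 ≤ a → a ≤ b → b ≤ 2 * U → 0 ≤ ρ →
      (∀ u ∈ Set.Icc a b, ρ * Real.exp u ≤ |Chebyshev.psi (Real.exp u) - Real.exp u|) →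
      (b - a) * U ^ 4 * ρ ^ 2 ≤ B := by
  obtain ⟨B, hB, h⟩ := exists_integral_sq_psi_sub_le
  refine ⟨16 * Real.exp 1 ^ 2 * B, by positivity, fun U hU a b ρ ha hab hb hρ hle => ?_⟩
  -- For `u ≤ 2U` the damping `e^{-(σ-1)u}` is then at least `e^{-1}`, so it costs only a constant.
  set σ : ℝ := 1 + 1 / (2 * U) with hσ
  have hσ1 : 1 < σ := by rw [hσ]; have : 0 < 1 / (2 * U) := by positivity
                         linarith
  have hσ2 : σ ≤ 2 := by
    have : 1 / (2 * U) ≤ 1 := by rw [div_le_one (by linarith)]; linarith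
    linarith
  have hi : Integrable fun u : ℝ => (u ^ 2 * ‖psiDamped σ u‖) ^ 2 := by
    have hm := memLp_pow_mul_psiDamped 2 hσ1
    refine ((memLp_two_iff_integrable_sq_norm hm.1).1 hm).congr
      (Filter.Eventually.of_forall fun u => ?_)
    simp
  have hset : ∫ u in Set.Icc a b, (u ^ 2 * ‖psiDamped σ u‖) ^ 2 ≤ B :=
    (setIntegral_le_integral hi (Filter.Eventually.of_forall fun u => by positivity)).trans
      (h σ hσ1 hσ2)
  set c : ℝ := ((U / 2) ^ 2 * (ρ * Real.exp (-1))) ^ 2 with hc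
  have hlow : ∫ _ in Set.Icc a b, c ≤ ∫ u in Set.Icc a b, (u ^ 2 * ‖psiDamped σ u‖) ^ 2 := by
    refine setIntegral_mono_on (by simp) hi.integrableOn measurableSet_Icc
      fun u hu => ?_
    have hu0 : 0 < u := by linarith [hu.1]
    rw [hc]
    have h1 : ρ * Real.exp (-1) ≤ ‖psiDamped σ u‖ := by
      rw [psiDamped, Set.indicator_of_mem (by exact hu0), Complex.norm_real, Real.norm_eq_abs,
        abs_mul, abs_of_pos (Real.exp_pos (-σ * u))]
      calc ρ * Real.exp (-1) ≤ ρ * Real.exp (-(1 / (2 * U)) * u) := by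
            gcongr
            rw [neg_mul, neg_le_neg_iff, one_div, inv_mul_le_iff₀ (by linarith)]
            linarith [hu.2]
        _ = ρ * Real.exp u * Real.exp (-σ * u) := by
            rw [mul_assoc, ← Real.exp_add, hσ]; ring_nf
        _ ≤ _ := by gcongr; exact hle u hu
    have h2 : U / 2 ≤ u := by linarith [hu.1]
    gcongr
  rw [setIntegral_const, smul_eq_mul, Measure.real, Real.volume_Icc,
    ENNReal.toReal_ofReal (by linarith)] at hlow
  have h3 : (b - a) * c ≤ B := hlow.trans hset
  have e : (b - a) * U ^ 4 * ρ ^ 2 = 16 * Real.exp 1 ^ 2 * ((b - a) * c) := by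
    rw [hc, Real.exp_neg]
    field_simp
    ring
  rw [e]
  gcongr

theorem exp_le_one_add_two_mul {w : ℝ} (h0 : 0 ≤ w) (h1 : w ≤ 1) : Real.exp w ≤ 1 + 2 * w := by
  have h := Real.abs_exp_sub_one_le (x := w) (by rwa [abs_of_nonneg h0])
  rw [abs_of_nonneg h0] at h
  linarith [le_abs_self (Real.exp w - 1)]

/-- The prime number theorem with error term `O(x / log x)`. -/
theorem exists_abs_psi_sub_mul_log_le :
    ∃ K : ℝ, 0 < K ∧ ∀ x : ℝ, 1 ≤ x → |Chebyshev.psi x - x| * Real.log x ≤ K * x := by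
  obtain ⟨B, hB, h⟩ := exists_mul_sq_le_of_le_abs_psi_sub
  set K := 64 * B + 6 with hK
  refine ⟨K, by positivity, fun x hx => ?_⟩
  have hx0 : 0 < x := by linarith
  have hψx := abs_psi_sub_le hx0.le
  set U := Real.log x with hU
  have hxU : Real.exp U = x := Real.exp_log hx0
  -- For `U ≤ K/6` Chebyshev's bound suffices. Otherwise an error above `δ x`, `δ = K/U`, persists
  -- at relative size `δ/2` on an interval of length `δ/16` in `u`, because `ψ` is monotone: to the
  -- right of `U` if `ψ(x) ≥ x`, to the left if not. The mean square bound then reads `K³ U / 64 ≤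
  -- B`, contradicting `K = 64 B + 6`.
  have hU0 : 0 ≤ U := Real.log_nonneg hx
  rcases le_or_gt U (K / 6) with hsmall | hlarge
  · calc |Chebyshev.psi x - x| * U ≤ 6 * x * (K / 6) := by gcongr
      _ = K * x := by ring
  have hU1 : 1 < U := by linarith
  by_contra hcon
  rw [not_le] at hcon
  set δ := K / U with hδ
  have hδ0 : 0 < δ := by positivity
  have hδ6 : δ ≤ 6 := by rw [hδ, div_le_iff₀ (by linarith)]; linarith
  have hδU : δ * U = K := by rw [hδ]; field_simp
  have hbig : δ * x < |Chebyshev.psi x - x| := by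
    refine lt_of_mul_lt_mul_right ?_ hU0
    calc δ * x * U = δ * U * x := by ring
      _ = K * x := by rw [hδU]
      _ < _ := hcon
  have hfin : ∀ a b : ℝ, b - a = δ / 16 → U / 2 ≤ a → b ≤ 2 * U →
      ¬ (∀ u ∈ Set.Icc a b, δ / 2 * Real.exp u ≤ |Chebyshev.psi (Real.exp u) - Real.exp u|) := by
    intro a b hab ha hb hle
    have := h U hU1.le a b (δ / 2) ha (by linarith) hb (by positivity) hle
    rw [hab] at this
    have e : δ / 16 * U ^ 4 * (δ / 2) ^ 2 = K ^ 3 * U / 64 := by rw [← hδU]; ring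
    rw [e] at this
    have hK6 : 6 ≤ K := by rw [hK]; linarith
    have : K ≤ K ^ 3 * U := by
      have h1 : 1 ≤ K ^ 2 * U := by nlinarith
      nlinarith
    linarith
  set w := δ / 16 with hw
  have hw0 : 0 < w := by positivity
  rcases le_total 0 (Chebyshev.psi x - x) with hs | hs
  · rw [abs_of_nonneg hs] at hbig
    refine hfin U (U + w) (by ring) (by linarith) (by linarith) fun v hv => ?_
    have hm : Chebyshev.psi x ≤ Chebyshev.psi (Real.exp v) := by
      refine Chebyshev.psi_mono ?_
      rw [← hxU]; exact Real.exp_le_exp.2 hv.1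
    have he : (1 - w) * Real.exp v ≤ x := by
      have h1 : 1 - w ≤ Real.exp (U - v) := by
        have := Real.add_one_le_exp (U - v)
        linarith [hv.2]
      calc (1 - w) * Real.exp v ≤ Real.exp (U - v) * Real.exp v := by gcongr
        _ = x := by rw [← Real.exp_add, sub_add_cancel, hxU]
    refine le_trans ?_ (le_abs_self _)
    have hE := Real.exp_pos v
    have h2 : (1 + δ) * ((1 - w) * Real.exp v) ≤ Chebyshev.psi (Real.exp v) := by
      calc (1 + δ) * ((1 - w) * Real.exp v) ≤ (1 + δ) * x := by gcongr
        _ ≤ _ := by linarith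
    have h3 : 1 + δ / 2 ≤ (1 + δ) * (1 - w) := by rw [hw]; nlinarith
    have h4 := mul_le_mul_of_nonneg_right h3 hE.le
    linarith
  · rw [abs_of_nonpos hs] at hbig
    refine hfin (U - w) U (by ring) (by linarith) (by linarith) fun v hv => ?_
    have hm : Chebyshev.psi (Real.exp v) ≤ Chebyshev.psi x := by
      refine Chebyshev.psi_mono ?_
      rw [← hxU]; exact Real.exp_le_exp.2 hv.2
    -- A deficit cannot exceed `x`, since `ψ ≥ 0`.
    have hδ1 : δ < 1 := by
      have := Chebyshev.psi_nonneg x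
      by_contra hc
      rw [not_lt] at hc
      nlinarith
    have he : x ≤ (1 + 2 * w) * Real.exp v := by
      have h1 : Real.exp (U - v) ≤ 1 + 2 * w :=
        (Real.exp_le_exp.2 (by linarith [hv.1])).trans
          (exp_le_one_add_two_mul hw0.le (by linarith))
      calc x = Real.exp (U - v) * Real.exp v := by rw [← Real.exp_add, sub_add_cancel, hxU]
        _ ≤ _ := by gcongr
    refine le_trans ?_ (neg_le_abs _)
    have hE := Real.exp_pos v
    have h2 : Chebyshev.psi (Real.exp v) ≤ (1 - δ) * ((1 + 2 * w) * Real.exp v) := by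
      calc Chebyshev.psi (Real.exp v) ≤ (1 - δ) * x := by linarith
        _ ≤ _ := by
          have : 0 ≤ 1 - δ := by linarith
          gcongr
    have h3 : (1 - δ) * (1 + 2 * w) ≤ 1 - δ / 2 := by rw [hw]; nlinarith
    have h4 := mul_le_mul_of_nonneg_right h3 hE.le
    linarith

/-! ### Convolution powers of `Λ` at squarefree integers. -/

open ArithmeticFunction in
theorem ArithmeticFunction.mul_apply_eq_sum_divisors (f g : ArithmeticFunction ℝ) (n : ℕ) :
    (f * g) n = ∑ d ∈ n.divisors, f d * g (n / d) := by
  rw [ArithmeticFunction.mul_apply, Nat.sum_divisorsAntidiagonal (f := fun a b => f a * g b)]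

theorem ArithmeticFunction.mul_nonneg' {f g : ArithmeticFunction ℝ} (hf : ∀ n, 0 ≤ f n)
    (hg : ∀ n, 0 ≤ g n) (n : ℕ) : 0 ≤ (f * g) n := by
  rw [ArithmeticFunction.mul_apply]
  exact Finset.sum_nonneg fun x _ => mul_nonneg (hf _) (hg _)

theorem ArithmeticFunction.pow_nonneg' {f : ArithmeticFunction ℝ} (hf : ∀ n, 0 ≤ f n)
    (k n : ℕ) : 0 ≤ (f ^ k) n := by
  induction k generalizing n with
  | zero => rw [pow_zero, ArithmeticFunction.one_apply]; split_ifs <;> norm_num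
  | succ k ih => rw [pow_succ']; exact mul_nonneg' hf ih n

theorem ArithmeticFunction.mul_le_mul_left' {f g h : ArithmeticFunction ℝ} (hf : ∀ n, 0 ≤ f n)
    (hgh : ∀ n, g n ≤ h n) (n : ℕ) : (f * g) n ≤ (f * h) n := by
  rw [ArithmeticFunction.mul_apply, ArithmeticFunction.mul_apply]
  exact Finset.sum_le_sum fun x _ => mul_le_mul_of_nonneg_left (hgh _) (hf _)

theorem vonMangoldtConv_zero : vonMangoldtConv 0 = 1 := pow_zero _

theorem vonMangoldtConv_one : vonMangoldtConv 1 = ArithmeticFunction.vonMangoldt := pow_one _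

theorem vonMangoldtConv_succ (k : ℕ) :
    vonMangoldtConv (k + 1) = ArithmeticFunction.vonMangoldt * vonMangoldtConv k := pow_succ' _ _

theorem vonMangoldtConv_nonneg (k n : ℕ) : 0 ≤ vonMangoldtConv k n :=
  ArithmeticFunction.pow_nonneg' (fun _ => ArithmeticFunction.vonMangoldt_nonneg) k n

/-- Induction from `∑_{d ∣ n} Λ(d) = log n`, bounding `log (n / d)` by `log n`. -/
theorem vonMangoldtConv_le_log_pow (k : ℕ) {n : ℕ} (hn : n ≠ 0) :
    vonMangoldtConv k n ≤ Real.log n ^ k := by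
  induction k generalizing n with
  | zero =>
    rw [vonMangoldtConv_zero, pow_zero, ArithmeticFunction.one_apply]
    split_ifs <;> norm_num
  | succ k ih =>
    rw [vonMangoldtConv_succ, ArithmeticFunction.mul_apply_eq_sum_divisors]
    calc _ ≤ ∑ d ∈ n.divisors, ArithmeticFunction.vonMangoldt d * Real.log n ^ k := by
          refine Finset.sum_le_sum fun d hd => ?_
          have hd' := Nat.dvd_of_mem_divisors hd
          have h0 : n / d ≠ 0 := (Nat.div_pos (Nat.le_of_dvd (Nat.pos_of_ne_zero hn) hd')
            (Nat.pos_of_mem_divisors hd)).ne'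
          refine mul_le_mul_of_nonneg_left ((ih h0).trans ?_)
            ArithmeticFunction.vonMangoldt_nonneg
          have : Real.log (n / d : ℕ) ≤ Real.log n :=
            Real.log_le_log (by exact_mod_cast Nat.pos_of_ne_zero h0)
              (by exact_mod_cast Nat.div_le_self n d)
          have : 0 ≤ Real.log (n / d : ℕ) := Real.log_natCast_nonneg _
          gcongr
      _ = _ := by
          rw [← Finset.sum_mul, ArithmeticFunction.vonMangoldt_sum, pow_succ']

/-- Convolution powers at squarefree integers of a function supported on prime powers. -/
theorem ArithmeticFunction.pow_apply_of_squarefree {f : ArithmeticFunction ℝ}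
    (hf : ∀ n, ¬ IsPrimePow n → f n = 0) (k : ℕ) {n : ℕ} (hn : Squarefree n) :
    (f ^ k) n =
      if n.primeFactors.card = k then (k.factorial : ℝ) * ∏ p ∈ n.primeFactors, f p else 0 := by
  induction k generalizing n with
  | zero =>
    rw [pow_zero, ArithmeticFunction.one_apply]
    have h0 : n ≠ 0 := hn.ne_zero
    have : n.primeFactors.card = 0 ↔ n = 1 := by
      rw [Finset.card_eq_zero, Nat.primeFactors_eq_empty]; simp [h0]
    by_cases h1 : n = 1
    · subst h1; simp
    · rw [if_neg h1, if_neg (by rwa [this])]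
  | succ k ih =>
    have h0 : n ≠ 0 := hn.ne_zero
    rw [pow_succ', ArithmeticFunction.mul_apply_eq_sum_divisors]
    have hsub : n.primeFactors ⊆ n.divisors := fun p hp =>
      Nat.mem_divisors.2 ⟨Nat.dvd_of_mem_primeFactors hp, h0⟩
    -- A squarefree prime power is a prime, so only prime divisors contribute. Each contributes the
    -- same amount, and there are `k + 1` of them, which turns `k!` into `(k + 1)!`.
    rw [← Finset.sum_subset hsub (fun d hd hd' => by
      rw [hf d, zero_mul]
      intro hpp
      obtain ⟨p, m, hp, hm, rfl⟩ := (isPrimePow_nat_iff _).1 hpp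
      have hsq : Squarefree (p ^ m) := hn.squarefree_of_dvd (Nat.dvd_of_mem_divisors hd)
      have hm1 : m = 1 := by
        by_contra hne
        exact hp.one_lt.ne' (Nat.squarefree_pow_iff hp.one_lt.ne' hm.ne' |>.1 hsq |>.2 |> fun h =>
          absurd h hne)
      subst hm1
      exact hd' (Nat.mem_primeFactors.2 ⟨by simpa using hp, Nat.dvd_of_mem_divisors hd, h0⟩))]
    have hterm : ∀ p ∈ n.primeFactors, f p * (f ^ k) (n / p) =
        if n.primeFactors.card = k + 1 then (k.factorial : ℝ) * ∏ q ∈ n.primeFactors, f q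
        else 0 := by
      intro p hp
      have hpp := Nat.prime_of_mem_primeFactors hp
      have hpd := Nat.dvd_of_mem_primeFactors hp
      have hsq : Squarefree (n / p) := hn.squarefree_of_dvd (Nat.div_dvd_of_dvd hpd)
      have hmul : p * (n / p) = n := Nat.mul_div_cancel' hpd
      have hcop : Nat.Coprime p (n / p) := by
        have := hn; rw [← hmul] at this; exact Nat.coprime_of_squarefree_mul this
      have hpf : n.primeFactors = insert p (n / p).primeFactors := by
        conv_lhs => rw [← hmul]
        rw [hcop.primeFactors_mul, hpp.primeFactors]; rfl
      have hnot : p ∉ (n / p).primeFactors := fun h =>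
        hpp.one_lt.ne' (Nat.dvd_one.1 (hcop ▸ Nat.dvd_gcd dvd_rfl (Nat.dvd_of_mem_primeFactors h)))
      rw [ih hsq, hpf, Finset.card_insert_of_notMem hnot, Finset.prod_insert hnot]
      by_cases hc : (n / p).primeFactors.card = k
      · rw [if_pos hc, if_pos (by rw [hc])]; ring
      · rw [if_neg hc, if_neg (by omega), mul_zero]
    rw [Finset.sum_congr rfl hterm, Finset.sum_const, nsmul_eq_mul]
    split_ifs with hc
    · rw [hc, Nat.factorial_succ]; push_cast; ring
    · simp

/-- Extracts a prime from a squarefree argument. For `l = 0` the truncated `l - 1` is harmless: the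
factor `l` vanishes, as does `Λ_0` at `p * m > 1`. -/
theorem vonMangoldtConv_prime_mul {p m : ℕ} (hp : p.Prime) (h : Squarefree (p * m)) (l : ℕ) :
    vonMangoldtConv l (p * m) = l * Real.log p * vonMangoldtConv (l - 1) m := by
  have hΛ : ∀ n, ¬ IsPrimePow n → ArithmeticFunction.vonMangoldt n = 0 := fun n hn =>
    ArithmeticFunction.vonMangoldt_eq_zero_iff.2 hn
  have hcop : Nat.Coprime p m := Nat.coprime_of_squarefree_mul h
  have hm : Squarefree m := h.squarefree_of_dvd (Dvd.intro_left p rfl)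
  have hpf : (p * m).primeFactors = insert p m.primeFactors := by
    rw [hcop.primeFactors_mul, hp.primeFactors]; rfl
  have hnot : p ∉ m.primeFactors := fun h =>
    hp.one_lt.ne' (Nat.dvd_one.1 (hcop ▸ Nat.dvd_gcd dvd_rfl (Nat.dvd_of_mem_primeFactors h)))
  rw [vonMangoldtConv, vonMangoldtConv, ArithmeticFunction.pow_apply_of_squarefree hΛ _ h,
    ArithmeticFunction.pow_apply_of_squarefree hΛ _ hm, hpf, Finset.card_insert_of_notMem hnot,
    Finset.prod_insert hnot, ArithmeticFunction.vonMangoldt_apply_prime hp]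
  cases l with
  | zero => simp
  | succ l =>
    by_cases hc : m.primeFactors.card = l
    · rw [if_pos (by rw [hc]), if_pos (by simpa using hc), Nat.factorial_succ]
      push_cast
      ring
    · rw [if_neg (by omega), if_neg (by simpa using hc), mul_zero]

/-! ### Domination of `Λ_l` on non-squarefree integers. -/

/-- The restriction of an arithmetic function to the integers that are not squarefree. -/
noncomputable def nonSquarefreePart (f : ArithmeticFunction ℝ) : ArithmeticFunction ℝ :=
  ⟨fun n => open Classical in if Squarefree n then 0 else f n, by simp⟩

theorem nonSquarefreePart_of_squarefree (f : ArithmeticFunction ℝ) {n : ℕ} (h : Squarefree n) :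
    nonSquarefreePart f n = 0 := if_pos h

theorem nonSquarefreePart_of_not_squarefree (f : ArithmeticFunction ℝ) {n : ℕ}
    (h : ¬ Squarefree n) : nonSquarefreePart f n = f n := if_neg h

theorem nonSquarefreePart_nonneg {f : ArithmeticFunction ℝ} (hf : ∀ n, 0 ≤ f n) (n : ℕ) :
    0 ≤ nonSquarefreePart f n := by
  by_cases h : Squarefree n
  · rw [nonSquarefreePart_of_squarefree f h]
  · rw [nonSquarefreePart_of_not_squarefree f h]; exact hf n

/-- `Λ(n) (1 + log n)` on proper prime powers. -/
noncomputable def properPowerWeight : ArithmeticFunction ℝ :=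
  nonSquarefreePart ⟨fun n => ArithmeticFunction.vonMangoldt n * (1 + Real.log n), by simp⟩

theorem properPowerWeight_nonneg (n : ℕ) : 0 ≤ properPowerWeight n :=
  nonSquarefreePart_nonneg (fun n => mul_nonneg ArithmeticFunction.vonMangoldt_nonneg
    (add_nonneg zero_le_one (Real.log_natCast_nonneg n))) n

theorem properPowerWeight_of_squarefree {n : ℕ} (h : Squarefree n) : properPowerWeight n = 0 :=
  nonSquarefreePart_of_squarefree _ h

theorem properPowerWeight_of_not_squarefree {n : ℕ} (h : ¬ Squarefree n) :
    properPowerWeight n = ArithmeticFunction.vonMangoldt n * (1 + Real.log n) :=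
  nonSquarefreePart_of_not_squarefree _ h

theorem vonMangoldt_le_properPowerWeight {n : ℕ} (h : ¬ Squarefree n) :
    ArithmeticFunction.vonMangoldt n ≤ properPowerWeight n := by
  rw [properPowerWeight_of_not_squarefree h]
  exact le_mul_of_one_le_right ArithmeticFunction.vonMangoldt_nonneg
    (by linarith [Real.log_natCast_nonneg n])

/-- The reason for the factor `1 + log n` in the weight: besides `Λ` on proper prime powers, it must
dominate `log² p` at `p²`, the value left when two factors `Λ(p)` meet at the same prime. -/
theorem log_sq_le_properPowerWeight {p : ℕ} (hp : p.Prime) :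
    Real.log p * Real.log p ≤ properPowerWeight (p ^ 2) := by
  rw [properPowerWeight_of_not_squarefree (fun h => by
    have := h p ⟨1, by ring⟩
    exact hp.one_lt.ne' (Nat.isUnit_iff.1 this)),
    ArithmeticFunction.vonMangoldt_apply_pow (by norm_num),
    ArithmeticFunction.vonMangoldt_apply_prime hp, Nat.cast_pow, Real.log_pow]
  have := Real.log_natCast_nonneg p
  gcongr
  push_cast
  linarith

/-- If `n = d e` is not squarefree and `Λ(d) ≠ 0`, then `e` is not squarefree, or `d` is a proper
prime power, or `d = p` is a prime dividing a squarefree `e = p m`. The last case gives `log p ·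
Λ_l(p m) = l log² p · Λ_{l-1}(m)`, absorbed by the weight at `p²`. The three terms correspond to the
three cases. -/
theorem nonSquarefreePart_vonMangoldtConv_succ_le (l n : ℕ) :
    nonSquarefreePart (vonMangoldtConv (l + 1)) n ≤
      (ArithmeticFunction.vonMangoldt * nonSquarefreePart (vonMangoldtConv l)) n +
        (properPowerWeight * vonMangoldtConv l) n +
        l * (properPowerWeight * vonMangoldtConv (l - 1)) n := by
  have n1 := ArithmeticFunction.mul_nonneg' (f := ArithmeticFunction.vonMangoldt)
    (fun _ => ArithmeticFunction.vonMangoldt_nonneg)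
    (nonSquarefreePart_nonneg (vonMangoldtConv_nonneg l)) n
  have n2 := ArithmeticFunction.mul_nonneg' properPowerWeight_nonneg (vonMangoldtConv_nonneg l) n
  have n3 := ArithmeticFunction.mul_nonneg' properPowerWeight_nonneg
    (vonMangoldtConv_nonneg (l - 1)) n
  by_cases hn : Squarefree n
  · rw [nonSquarefreePart_of_squarefree _ hn]; positivity
  rcases eq_or_ne n 0 with rfl | h0
  · simp
  rw [nonSquarefreePart_of_not_squarefree _ hn, vonMangoldtConv_succ]
  simp only [ArithmeticFunction.mul_apply_eq_sum_divisors]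
  classical
  set T := n.divisors.filter fun d => d.Prime ∧ Squarefree (n / d) ∧ d ∣ n / d with hT
  have hterm : ∀ d ∈ n.divisors,
      ArithmeticFunction.vonMangoldt d * vonMangoldtConv l (n / d) ≤
        ArithmeticFunction.vonMangoldt d * nonSquarefreePart (vonMangoldtConv l) (n / d) +
        properPowerWeight d * vonMangoldtConv l (n / d) +
        (if d.Prime ∧ Squarefree (n / d) ∧ d ∣ n / d then
          Real.log d * vonMangoldtConv l (n / d) else 0) := by
    intro d hd
    have hΛ := ArithmeticFunction.vonMangoldt_nonneg (n := d)
    have hV := vonMangoldtConv_nonneg l (n / d)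
    have a1 := mul_nonneg hΛ (nonSquarefreePart_nonneg (vonMangoldtConv_nonneg l) (n / d))
    have a2 := mul_nonneg (properPowerWeight_nonneg d) hV
    have a3 : 0 ≤ (if d.Prime ∧ Squarefree (n / d) ∧ d ∣ n / d then
          Real.log d * vonMangoldtConv l (n / d) else 0) := by
      split_ifs
      · exact mul_nonneg (Real.log_natCast_nonneg d) hV
      · exact le_rfl
    by_cases he : Squarefree (n / d)
    · by_cases hds : Squarefree d
      · by_cases hpp : IsPrimePow d
        · obtain ⟨p, m, hp, hm, hpm⟩ := (isPrimePow_nat_iff _).1 hpp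
          have hm1 : m = 1 := by
            rw [← hpm] at hds
            by_contra hne
            exact hp.one_lt.ne'
              (((Nat.squarefree_pow_iff hp.one_lt.ne' hm.ne').1 hds).2 |> fun h => absurd h hne)
          have hdp : d.Prime := by rw [← hpm, hm1, pow_one]; exact hp
          have hdvd : d ∣ n / d := by
            by_contra hnd
            apply hn
            rw [← Nat.mul_div_cancel' (Nat.dvd_of_mem_divisors hd)]
            exact (Nat.squarefree_mul ((Nat.Prime.coprime_iff_not_dvd hdp).2 hnd)).2 ⟨hds, he⟩
          rw [if_pos ⟨hdp, he, hdvd⟩, ArithmeticFunction.vonMangoldt_apply_prime hdp]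
          rw [ArithmeticFunction.vonMangoldt_apply_prime hdp] at a1
          linarith
        · rw [ArithmeticFunction.vonMangoldt_eq_zero_iff.2 hpp]
          rw [ArithmeticFunction.vonMangoldt_eq_zero_iff.2 hpp] at a1
          linarith
      · have := mul_le_mul_of_nonneg_right (vonMangoldt_le_properPowerWeight hds) hV
        linarith
    · rw [nonSquarefreePart_of_not_squarefree _ he]
      linarith
  refine (Finset.sum_le_sum hterm).trans ?_
  rw [Finset.sum_add_distrib, Finset.sum_add_distrib, ← Finset.sum_filter, ← hT, Finset.mul_sum]
  refine add_le_add le_rfl ?_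
  have hsq : ∀ p ∈ T, p ^ 2 ∈ n.divisors ∧ Real.log p * vonMangoldtConv l (n / p) ≤
      l * (properPowerWeight (p ^ 2) * vonMangoldtConv (l - 1) (n / p ^ 2)) := by
    intro p hp
    rw [hT, Finset.mem_filter] at hp
    obtain ⟨hpd, hpp, hs, m, hm⟩ := hp
    have hpn : p * (n / p) = n := Nat.mul_div_cancel' (Nat.dvd_of_mem_divisors hpd)
    have hn2 : n = p ^ 2 * m := by rw [← hpn, hm]; ring
    have hdiv : n / p ^ 2 = m := by
      rw [hn2]; exact Nat.mul_div_cancel_left m (pow_pos hpp.pos 2)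
    refine ⟨Nat.mem_divisors.2 ⟨⟨m, hn2⟩, h0⟩, ?_⟩
    rw [hdiv, hm, vonMangoldtConv_prime_mul hpp (hm ▸ hs)]
    have h1 := log_sq_le_properPowerWeight hpp
    have h2 := vonMangoldtConv_nonneg (l - 1) m
    calc Real.log p * (l * Real.log p * vonMangoldtConv (l - 1) m)
        = l * ((Real.log p * Real.log p) * vonMangoldtConv (l - 1) m) := by ring
      _ ≤ _ := by gcongr
  calc ∑ p ∈ T, Real.log p * vonMangoldtConv l (n / p)
      ≤ ∑ p ∈ T, l * (properPowerWeight (p ^ 2) * vonMangoldtConv (l - 1) (n / p ^ 2)) :=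
        Finset.sum_le_sum fun p hp => (hsq p hp).2
    _ = ∑ d ∈ T.image (· ^ 2), l * (properPowerWeight d * vonMangoldtConv (l - 1) (n / d)) := by
        rw [Finset.sum_image]
        intro a _ b _ hab
        exact Nat.pow_left_injective (by norm_num : 2 ≠ 0) hab
    _ ≤ _ := by
        refine Finset.sum_le_sum_of_subset_of_nonneg ?_ fun d _ _ =>
          mul_nonneg (Nat.cast_nonneg l)
            (mul_nonneg (properPowerWeight_nonneg d) (vonMangoldtConv_nonneg _ _))
        intro d hd
        obtain ⟨p, hp, rfl⟩ := Finset.mem_image.1 hd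
        exact (hsq p hp).1

theorem nonSquarefreePart_vonMangoldt_le (n : ℕ) :
    nonSquarefreePart ArithmeticFunction.vonMangoldt n ≤ properPowerWeight n := by
  by_cases hn : Squarefree n
  · rw [nonSquarefreePart_of_squarefree _ hn]; exact properPowerWeight_nonneg n
  · rw [nonSquarefreePart_of_not_squarefree _ hn]; exact vonMangoldt_le_properPowerWeight hn

/-- Iterates the recursion; the family `w * Λ_j` is stable because convolving with `Λ` raises `j` by
one. -/
theorem exists_nonSquarefreePart_vonMangoldtConv_le (l : ℕ) :
    ∃ C : ℝ, 0 ≤ C ∧ ∀ n, nonSquarefreePart (vonMangoldtConv (l + 2)) n ≤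
      C * ((properPowerWeight * vonMangoldtConv (l + 1)) n +
        (properPowerWeight * vonMangoldtConv l) n) := by
  have hΛ0 : ∀ n, 0 ≤ ArithmeticFunction.vonMangoldt n := fun _ =>
    ArithmeticFunction.vonMangoldt_nonneg
  have hN : ∀ j n, 0 ≤ (properPowerWeight * vonMangoldtConv j) n := fun j n =>
    ArithmeticFunction.mul_nonneg' properPowerWeight_nonneg (vonMangoldtConv_nonneg j) n
  induction l with
  | zero =>
    refine ⟨2, by norm_num, fun n => ?_⟩
    have h := nonSquarefreePart_vonMangoldtConv_succ_le 1 n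
    have h2 : (ArithmeticFunction.vonMangoldt * nonSquarefreePart (vonMangoldtConv 1)) n ≤
        (properPowerWeight * vonMangoldtConv 1) n := by
      rw [mul_comm properPowerWeight, vonMangoldtConv_one]
      exact ArithmeticFunction.mul_le_mul_left' hΛ0 nonSquarefreePart_vonMangoldt_le n
    have h3 := hN 0 n
    simp only [Nat.cast_one, one_mul, Nat.sub_self] at h
    simp only [zero_add]
    linarith
  | succ l ih =>
    obtain ⟨C, hC, h⟩ := ih
    refine ⟨C + l + 3, by positivity, fun n => ?_⟩
    have h1 := nonSquarefreePart_vonMangoldtConv_succ_le (l + 2) n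
    have h2 : (ArithmeticFunction.vonMangoldt * nonSquarefreePart (vonMangoldtConv (l + 2))) n ≤
        C * ((properPowerWeight * vonMangoldtConv (l + 2)) n +
        (properPowerWeight * vonMangoldtConv (l + 1)) n) := by
      have e : ∀ j, properPowerWeight * vonMangoldtConv (j + 1) =
          ArithmeticFunction.vonMangoldt * (properPowerWeight * vonMangoldtConv j) := fun j => by
        rw [vonMangoldtConv_succ]; ring
      have e' : ∀ j, (properPowerWeight * vonMangoldtConv (j + 1)) n =
          ∑ x ∈ n.divisorsAntidiagonal,
            ArithmeticFunction.vonMangoldt x.1 * (properPowerWeight * vonMangoldtConv j) x.2 :=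
        fun j => by rw [e, ArithmeticFunction.mul_apply]
      rw [e' (l + 1), e' l, ArithmeticFunction.mul_apply, ← Finset.sum_add_distrib, Finset.mul_sum]
      refine Finset.sum_le_sum fun x _ => ?_
      calc _ ≤ ArithmeticFunction.vonMangoldt x.1 *
            (C * ((properPowerWeight * vonMangoldtConv (l + 1)) x.2 +
              (properPowerWeight * vonMangoldtConv l) x.2)) :=
            mul_le_mul_of_nonneg_left (h x.2) (hΛ0 x.1)
        _ = _ := by ring
    have e2 : l + 2 - 1 = l + 1 := rfl
    rw [e2] at h1
    push_cast at h1
    have h3 := hN (l + 1) n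
    have h4 := hN (l + 2) n
    have h5 : 0 ≤ (l : ℝ) := Nat.cast_nonneg l
    rw [show l + 1 + 2 = l + 2 + 1 from rfl, show l + 1 + 1 = l + 2 from rfl]
    nlinarith

/-! ### Reduction of `Λ_k Λ_l` to `(Λ²)^{*k}` and non-squarefree integers. -/

/-- The square of the von Mangoldt function. -/
noncomputable def vonMangoldtSq : ArithmeticFunction ℝ :=
  ⟨fun n => ArithmeticFunction.vonMangoldt n ^ 2, by simp⟩

theorem vonMangoldtSq_apply (n : ℕ) :
    vonMangoldtSq n = ArithmeticFunction.vonMangoldt n ^ 2 := rfl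

theorem vonMangoldtSq_nonneg (n : ℕ) : 0 ≤ vonMangoldtSq n := sq_nonneg _

theorem vonMangoldtSq_pow_le (k : ℕ) {n : ℕ} (hn : n ≠ 0) :
    (vonMangoldtSq ^ k) n ≤ Real.log n ^ k * vonMangoldtConv k n := by
  induction k generalizing n with
  | zero => simp [vonMangoldtConv_zero]
  | succ k ih =>
    rw [pow_succ', vonMangoldtConv_succ, ArithmeticFunction.mul_apply_eq_sum_divisors,
      ArithmeticFunction.mul_apply_eq_sum_divisors, Finset.mul_sum]
    refine Finset.sum_le_sum fun d hd => ?_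
    have hdvd := Nat.dvd_of_mem_divisors hd
    have hd0 : 0 < d := Nat.pos_of_mem_divisors hd
    have h0 : n / d ≠ 0 := (Nat.div_pos (Nat.le_of_dvd (Nat.pos_of_ne_zero hn) hdvd) hd0).ne'
    have l1 : Real.log (n / d : ℕ) ≤ Real.log n :=
      Real.log_le_log (by exact_mod_cast Nat.pos_of_ne_zero h0)
        (by exact_mod_cast Nat.div_le_self n d)
    have l2 : Real.log d ≤ Real.log n :=
      Real.log_le_log (by exact_mod_cast hd0)
        (by exact_mod_cast Nat.le_of_dvd (Nat.pos_of_ne_zero hn) hdvd)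
    have l3 : 0 ≤ Real.log (n / d : ℕ) := Real.log_natCast_nonneg _
    have hΛ := ArithmeticFunction.vonMangoldt_nonneg (n := d)
    have hΛl := (ArithmeticFunction.vonMangoldt_le_log (n := d)).trans l2
    have hV := vonMangoldtConv_nonneg k (n / d)
    have hb : vonMangoldtSq d ≤ Real.log n * ArithmeticFunction.vonMangoldt d := by
      rw [vonMangoldtSq_apply, sq]; gcongr
    calc vonMangoldtSq d * (vonMangoldtSq ^ k) (n / d)
        ≤ (Real.log n * ArithmeticFunction.vonMangoldt d) *
          (Real.log (n / d : ℕ) ^ k * vonMangoldtConv k (n / d)) :=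
          mul_le_mul hb (ih h0) (ArithmeticFunction.pow_nonneg' vonMangoldtSq_nonneg _ _)
            (mul_nonneg (hΛ.trans hΛl) hΛ)
      _ ≤ (Real.log n * ArithmeticFunction.vonMangoldt d) *
          (Real.log n ^ k * vonMangoldtConv k (n / d)) := by
          have := mul_nonneg (hΛ.trans hΛl) hΛ
          gcongr
      _ = _ := by ring

/-- At squarefree `n` one factor vanishes, since the number of prime factors cannot be both `k` and
`l`; elsewhere `Λ_k ≤ log^k`. -/
theorem vonMangoldtConv_mul_le_of_ne {k l : ℕ} (hkl : k ≠ l) {n : ℕ} (hn : n ≠ 0) :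
    vonMangoldtConv k n * vonMangoldtConv l n ≤
      Real.log n ^ k * nonSquarefreePart (vonMangoldtConv l) n := by
  have hΛ : ∀ n, ¬ IsPrimePow n → ArithmeticFunction.vonMangoldt n = 0 := fun n hn =>
    ArithmeticFunction.vonMangoldt_eq_zero_iff.2 hn
  by_cases h : Squarefree n
  · rw [nonSquarefreePart_of_squarefree _ h, vonMangoldtConv, vonMangoldtConv,
      ArithmeticFunction.pow_apply_of_squarefree hΛ _ h,
      ArithmeticFunction.pow_apply_of_squarefree hΛ _ h]
    split_ifs with h1 h2
    · exact absurd (h1.symm.trans h2) hkl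
    all_goals simp
  · rw [nonSquarefreePart_of_not_squarefree _ h]
    exact mul_le_mul_of_nonneg_right (vonMangoldtConv_le_log_pow k hn) (vonMangoldtConv_nonneg l n)

/-- At squarefree `n` both terms are `(k!)² ∏ log² p`, or both are zero; elsewhere each is bounded
separately. -/
theorem abs_vonMangoldtConv_sq_sub_le (k : ℕ) {n : ℕ} (hn : n ≠ 0) :
    |vonMangoldtConv k n * vonMangoldtConv k n - k.factorial * (vonMangoldtSq ^ k) n| ≤
      (1 + k.factorial) * (Real.log n ^ k * nonSquarefreePart (vonMangoldtConv k) n) := by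
  have hΛ : ∀ n, ¬ IsPrimePow n → ArithmeticFunction.vonMangoldt n = 0 := fun n hn =>
    ArithmeticFunction.vonMangoldt_eq_zero_iff.2 hn
  have hΛ2 : ∀ n, ¬ IsPrimePow n → vonMangoldtSq n = 0 := fun n hn => by
    rw [vonMangoldtSq_apply, hΛ n hn]; norm_num
  by_cases h : Squarefree n
  · rw [nonSquarefreePart_of_squarefree _ h, vonMangoldtConv,
      ArithmeticFunction.pow_apply_of_squarefree hΛ _ h,
      ArithmeticFunction.pow_apply_of_squarefree hΛ2 _ h]
    split_ifs with h1
    · simp only [vonMangoldtSq_apply, Finset.prod_pow]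
      rw [mul_zero, mul_zero]
      refine le_of_eq (abs_eq_zero.2 ?_)
      ring
    · simp
  · rw [nonSquarefreePart_of_not_squarefree _ h]
    have h1 := mul_le_mul_of_nonneg_right (vonMangoldtConv_le_log_pow k hn)
      (vonMangoldtConv_nonneg k n)
    have h2 := vonMangoldtSq_pow_le k hn
    have h3 := ArithmeticFunction.pow_nonneg' vonMangoldtSq_nonneg k n
    have h4 := mul_nonneg (vonMangoldtConv_nonneg k n) (vonMangoldtConv_nonneg k n)
    have h5 : (0 : ℝ) ≤ k.factorial := Nat.cast_nonneg _
    have h6 := mul_le_mul_of_nonneg_left h2 h5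
    have h7 := mul_nonneg h5 h3
    have h8 := h4.trans h1
    have h9 := mul_nonneg h5 h8
    rw [abs_le]
    constructor <;> linarith

/-! ### Chebyshev and Mertens bounds; negligibility of non-squarefree integers. -/

/-- The summatory function of an arithmetic function. -/
noncomputable def summatory (f : ArithmeticFunction ℝ) (x : ℝ) : ℝ :=
  ∑ n ∈ Finset.Icc 1 ⌊x⌋₊, f n

theorem le_of_mem_Icc_floor {x : ℝ} {n : ℕ} (hn : n ∈ Finset.Icc 1 ⌊x⌋₊) :
    (1 : ℝ) ≤ n ∧ (n : ℝ) ≤ x := by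
  obtain ⟨h1, h2⟩ := Finset.mem_Icc.1 hn
  exact ⟨by exact_mod_cast h1, (Nat.le_floor_iff' (by omega)).1 h2⟩

theorem summatory_mul (f g : ArithmeticFunction ℝ) (x : ℝ) :
    summatory (f * g) x = ∑ d ∈ Finset.Icc 1 ⌊x⌋₊, f d * summatory g (x / d) := by
  have h := ArithmeticFunction.sum_Ioc_mul_eq_sum_sum f g ⌊x⌋₊
  simp only [summatory]
  have e : ∀ m, Finset.Icc 1 m = Finset.Ioc 0 m := fun m => rfl
  simp only [e, Nat.floor_div_natCast]
  exact h

theorem summatory_nonneg {f : ArithmeticFunction ℝ} (hf : ∀ n, 0 ≤ f n) (x : ℝ) :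
    0 ≤ summatory f x := Finset.sum_nonneg fun n _ => hf n

theorem summatory_of_lt_two {f : ArithmeticFunction ℝ} (h1 : f 1 = 0) {x : ℝ} (hx : x < 2) :
    summatory f x = 0 := by
  refine Finset.sum_eq_zero fun n hn => ?_
  obtain ⟨a, b⟩ := le_of_mem_Icc_floor hn
  have : n < 2 := by exact_mod_cast b.trans_lt hx
  have : n = 1 := by have : 1 ≤ n := (Finset.mem_Icc.1 hn).1
                     omega
  rw [this, h1]

theorem summatory_vonMangoldt (x : ℝ) :
    summatory ArithmeticFunction.vonMangoldt x = Chebyshev.psi x := rfl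

theorem summatory_vonMangoldt_le {x : ℝ} (hx : 0 ≤ x) :
    summatory ArithmeticFunction.vonMangoldt x ≤ 7 * x := by
  have := (abs_le.1 (abs_psi_sub_le hx)).2
  rw [summatory_vonMangoldt]; linarith

theorem half_lt_log {x : ℝ} (hx : 2 ≤ x) : 1 / 2 < Real.log x := by
  have := Real.log_le_log (by norm_num) hx
  linarith [Real.log_two_gt_d9]

/-- Upper bound in Mertens' first theorem. -/
theorem sum_vonMangoldt_div_le {x : ℝ} (hx : 2 ≤ x) {y : ℝ} (hy : 1 ≤ y) (hyx : y ≤ x) :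
    ∑ d ∈ Finset.Icc 1 ⌊y⌋₊, ArithmeticFunction.vonMangoldt d / d ≤ 15 * Real.log x := by
  have hy0 : 0 < y := by linarith
  have h1 := summatory_mul ArithmeticFunction.vonMangoldt
    ((ArithmeticFunction.zeta : ArithmeticFunction ℕ) : ArithmeticFunction ℝ) y
  rw [ArithmeticFunction.vonMangoldt_mul_zeta] at h1
  have h2 : summatory ArithmeticFunction.log y ≤ y * Real.log x := by
    calc _ ≤ ∑ n ∈ Finset.Icc 1 ⌊y⌋₊, Real.log x := by
          refine Finset.sum_le_sum fun n hn => ?_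
          obtain ⟨a, b⟩ := le_of_mem_Icc_floor hn
          rw [ArithmeticFunction.log_apply]
          exact Real.log_le_log (by linarith) (by linarith)
      _ = ⌊y⌋₊ * Real.log x := by simp
      _ ≤ _ := by
        have := half_lt_log hx
        gcongr
        exact Nat.floor_le hy0.le
  have h3 : y * ∑ d ∈ Finset.Icc 1 ⌊y⌋₊, ArithmeticFunction.vonMangoldt d / d ≤
      summatory ArithmeticFunction.log y + summatory ArithmeticFunction.vonMangoldt y := by
    rw [h1, summatory, ← Finset.sum_add_distrib, Finset.mul_sum]
    refine Finset.sum_le_sum fun d hd => ?_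
    have hz : summatory
        ((ArithmeticFunction.zeta : ArithmeticFunction ℕ) : ArithmeticFunction ℝ) (y / d)
        = ⌊y / d⌋₊ := by
      rw [summatory, Finset.sum_congr rfl (g := fun _ => (1 : ℝ))]
      · simp
      · intro n hn
        have : n ≠ 0 := by have := (Finset.mem_Icc.1 hn).1; omega
        simp [this]
    rw [hz]
    have h4 : y / d ≤ ⌊y / d⌋₊ + 1 := (Nat.lt_floor_add_one _).le
    have hΛ := ArithmeticFunction.vonMangoldt_nonneg (n := d)
    calc y * (ArithmeticFunction.vonMangoldt d / d)
        = ArithmeticFunction.vonMangoldt d * (y / d) := by ring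
      _ ≤ ArithmeticFunction.vonMangoldt d * (⌊y / d⌋₊ + 1) := by gcongr
      _ = _ := by ring
  have h5 := summatory_vonMangoldt_le hy0.le
  -- The constant `15` is `1 + 7 · 2`: the Chebyshev term `7 y` is at most `14 y log x`.
  have h6 := half_lt_log hx
  have h7 : y * ∑ d ∈ Finset.Icc 1 ⌊y⌋₊, ArithmeticFunction.vonMangoldt d / d ≤
      y * (15 * Real.log x) := by nlinarith
  exact le_of_mul_le_mul_left h7 hy0

/-- The logarithm is taken at a fixed `x ≥ y`, so the induction passes to `y / d` without changing
that factor. -/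
theorem exists_summatory_vonMangoldtConv_succ_le (j : ℕ) :
    ∃ C : ℝ, 0 ≤ C ∧ ∀ x : ℝ, 2 ≤ x → ∀ y, 1 ≤ y → y ≤ x →
      summatory (vonMangoldtConv (j + 1)) y ≤ C * (y * Real.log x ^ j) := by
  induction j with
  | zero =>
    refine ⟨7, by norm_num, fun x hx y hy hyx => ?_⟩
    rw [zero_add, vonMangoldtConv_one, pow_zero, mul_one]
    exact summatory_vonMangoldt_le (by linarith)
  | succ j ih =>
    obtain ⟨C, hC, h⟩ := ih
    refine ⟨15 * C, by positivity, fun x hx y hy hyx => ?_⟩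
    have hL := half_lt_log hx
    have hLj : 0 ≤ Real.log x ^ j := pow_nonneg (by linarith) _
    rw [vonMangoldtConv_succ, summatory_mul]
    calc _ ≤ ∑ d ∈ Finset.Icc 1 ⌊y⌋₊,
          C * (y * Real.log x ^ j) * (ArithmeticFunction.vonMangoldt d / d) := by
          refine Finset.sum_le_sum fun d hd => ?_
          obtain ⟨a, b⟩ := le_of_mem_Icc_floor hd
          have h1 := h x hx (y / d) (by rw [le_div_iff₀ (by linarith)]; linarith)
            ((div_le_self (by linarith) a).trans hyx)
          have := mul_le_mul_of_nonneg_left h1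
            (ArithmeticFunction.vonMangoldt_nonneg (n := d))
          refine this.trans (le_of_eq ?_)
          ring
      _ = C * (y * Real.log x ^ j) *
          ∑ d ∈ Finset.Icc 1 ⌊y⌋₊, ArithmeticFunction.vonMangoldt d / d := by
          rw [Finset.mul_sum]
      _ ≤ C * (y * Real.log x ^ j) * (15 * Real.log x) := by
          have : 0 ≤ C * (y * Real.log x ^ j) := by positivity
          gcongr
          exact sum_vonMangoldt_div_le hx hy hyx
      _ = _ := by ring

/-- Multiplying by `1 + log y` makes the bound uniform in `j`: it also covers `Λ_0`, whose sum is
`1`, through `1 + log y ≤ y`. -/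
theorem exists_summatory_vonMangoldtConv_mul_le (j : ℕ) :
    ∃ C : ℝ, 0 ≤ C ∧ ∀ x : ℝ, 2 ≤ x → ∀ y, 1 ≤ y → y ≤ x →
      summatory (vonMangoldtConv j) y * (1 + Real.log y) ≤ C * (y * Real.log x ^ j) := by
  cases j with
  | zero =>
    refine ⟨1, by norm_num, fun x hx y hy hyx => ?_⟩
    have h1 : summatory (vonMangoldtConv 0) y = 1 := by
      rw [summatory, vonMangoldtConv_zero, Finset.sum_eq_single_of_mem 1]
      · simp
      · rw [Finset.mem_Icc]; exact ⟨le_rfl, Nat.le_floor (by simpa using hy)⟩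
      · intro n _ hn; exact ArithmeticFunction.one_apply_ne hn
    rw [h1]
    have := Real.log_le_sub_one_of_pos (by linarith : 0 < y)
    simp only [pow_zero]; linarith
  | succ j =>
    obtain ⟨C, hC, h⟩ := exists_summatory_vonMangoldtConv_succ_le j
    refine ⟨3 * C, by positivity, fun x hx y hy hyx => ?_⟩
    have hL := half_lt_log hx
    have hLj : 0 ≤ Real.log x ^ j := pow_nonneg (by linarith) _
    have hly : 1 + Real.log y ≤ 3 * Real.log x := by
      have := Real.log_le_log (by linarith) hyx
      linarith
    have hly0 := Real.log_nonneg hy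
    calc _ ≤ C * (y * Real.log x ^ j) * (3 * Real.log x) := by
          gcongr
          exact h x hx y hy hyx
      _ = _ := by ring

theorem sum_properPower_vonMangoldt_le :
    ∃ C : ℝ, 0 ≤ C ∧ ∀ n : ℕ,
      ∑ k ∈ Finset.Icc 1 n, nonSquarefreePart ArithmeticFunction.vonMangoldt k ≤ C * √n := by
  obtain ⟨C, hC⟩ := Chebyshev.psi_sub_theta_le_mul_sqrt
  refine ⟨max C 0, le_max_right _ _, fun n => ?_⟩
  have h := hC n
  rw [Chebyshev.psi_sub_theta_eq_sum_not_prime, Nat.floor_natCast] at h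
  calc _ ≤ ∑ k ∈ Finset.Ioc 0 n with ¬ k.Prime, ArithmeticFunction.vonMangoldt k := by
        rw [Finset.sum_filter]
        refine Finset.sum_le_sum fun k _ => ?_
        by_cases hk : k.Prime
        · rw [nonSquarefreePart_of_squarefree _ hk.prime.squarefree, if_neg (not_not.2 hk)]
        · rw [if_pos hk]
          by_cases hs : Squarefree k
          · rw [nonSquarefreePart_of_squarefree _ hs]
            exact ArithmeticFunction.vonMangoldt_nonneg
          · rw [nonSquarefreePart_of_not_squarefree _ hs]
    _ ≤ C * √n := h
    _ ≤ _ := by gcongr; exact le_max_left _ _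

/-- The proper prime power part of `ψ` is `O(√x)`, so its Dirichlet series converges at `3/4`; the
two factors `1 + log m` cost at most `81 m ^ (1/4)`. -/
theorem exists_sum_properPowerWeight_le :
    ∃ W : ℝ, 0 ≤ W ∧ ∀ N : ℕ,
      ∑ m ∈ Finset.Icc 1 N, properPowerWeight m * (1 + Real.log m) / m ≤ W := by
  obtain ⟨C, hC, h⟩ := sum_properPower_vonMangoldt_le
  have hnn : ∀ n, 0 ≤ nonSquarefreePart ArithmeticFunction.vonMangoldt n :=
    nonSquarefreePart_nonneg fun _ => ArithmeticFunction.vonMangoldt_nonneg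
  have hsum := LSeriesSummable_of_sum_norm_bigO_and_nonneg (r := 1 / 2) (s := (3 / 4 : ℝ))
    (f := fun n => nonSquarefreePart ArithmeticFunction.vonMangoldt n)
    (by
      refine Asymptotics.IsBigO.of_bound C (Filter.Eventually.of_forall fun n => ?_)
      rw [Real.norm_of_nonneg (Finset.sum_nonneg fun k _ => hnn k),
        Real.norm_of_nonneg (by positivity), ← Real.sqrt_eq_rpow]
      exact h n) hnn (by norm_num) (by simp; norm_num)
  have hs2 := hsum.norm
  set W := ∑' n : ℕ, ‖LSeries.term
    (fun n => ((nonSquarefreePart ArithmeticFunction.vonMangoldt n : ℝ) : ℂ)) (3 / 4 : ℝ) n‖ with hW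
  refine ⟨81 * W, by positivity, fun N => ?_⟩
  have hle := hs2.sum_le_tsum (Finset.Icc 1 N) (fun n _ => norm_nonneg _)
  refine le_trans ?_ (mul_le_mul_of_nonneg_left hle (by norm_num))
  rw [Finset.mul_sum]
  refine Finset.sum_le_sum fun m hm => ?_
  have hm1 : 1 ≤ m := (Finset.mem_Icc.1 hm).1
  have hm0 : (0 : ℝ) < m := by exact_mod_cast hm1
  have hm1' : (1 : ℝ) ≤ m := by exact_mod_cast hm1
  rw [LSeries.term_of_ne_zero (by omega), norm_div, Complex.norm_real,
    Real.norm_of_nonneg (hnn m), Complex.norm_natCast_cpow_of_pos (by omega), Complex.ofReal_re]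
  have hlog : 1 + Real.log m ≤ 9 * (m : ℝ) ^ (1 / 8 : ℝ) := by
    have h1 := Real.log_le_rpow_div hm0.le (by norm_num : (0 : ℝ) < 1 / 8)
    have h2 : 1 ≤ (m : ℝ) ^ (1 / 8 : ℝ) := Real.one_le_rpow hm1' (by norm_num)
    linarith
  have hl0 : 0 ≤ 1 + Real.log m := by linarith [Real.log_nonneg hm1']
  have hc : properPowerWeight m =
      nonSquarefreePart ArithmeticFunction.vonMangoldt m * (1 + Real.log m) := by
    by_cases hs : Squarefree m
    · rw [nonSquarefreePart_of_squarefree _ hs, properPowerWeight_of_squarefree hs, zero_mul]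
    · rw [nonSquarefreePart_of_not_squarefree _ hs, properPowerWeight_of_not_squarefree hs]
  have he : (m : ℝ) = (m : ℝ) ^ (3 / 4 : ℝ) * ((m : ℝ) ^ (1 / 8 : ℝ)) ^ 2 := by
    rw [← Real.rpow_natCast, ← Real.rpow_mul hm0.le, ← Real.rpow_add hm0]; norm_num
  have hsq : (1 + Real.log m) ^ 2 ≤ 81 * ((m : ℝ) ^ (1 / 8 : ℝ)) ^ 2 := by
    calc (1 + Real.log m) ^ 2 ≤ (9 * (m : ℝ) ^ (1 / 8 : ℝ)) ^ 2 := by gcongr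
      _ = _ := by ring
  rw [hc, div_le_iff₀ hm0]
  have hp : 0 < (m : ℝ) ^ (3 / 4 : ℝ) := by positivity
  calc _ = nonSquarefreePart ArithmeticFunction.vonMangoldt m * (1 + Real.log m) ^ 2 := by ring
    _ ≤ nonSquarefreePart ArithmeticFunction.vonMangoldt m *
        (81 * ((m : ℝ) ^ (1 / 8 : ℝ)) ^ 2) := mul_le_mul_of_nonneg_left hsq (hnn m)
    _ = 81 * (nonSquarefreePart ArithmeticFunction.vonMangoldt m / (m : ℝ) ^ (3 / 4 : ℝ)) *
        ((m : ℝ) ^ (3 / 4 : ℝ) * ((m : ℝ) ^ (1 / 8 : ℝ)) ^ 2) := by field_simp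
    _ = _ := by rw [← he]

theorem exists_summatory_properPowerWeight_mul_le (j : ℕ) :
    ∃ C : ℝ, 0 ≤ C ∧ ∀ x : ℝ, 2 ≤ x →
      summatory (properPowerWeight * vonMangoldtConv j) x * Real.log x ≤
        C * (x * Real.log x ^ j) := by
  obtain ⟨C, hC, h⟩ := exists_summatory_vonMangoldtConv_mul_le j
  obtain ⟨W, hW, hw⟩ := exists_sum_properPowerWeight_le
  refine ⟨C * W, by positivity, fun x hx => ?_⟩
  have hLj : 0 ≤ Real.log x ^ j := pow_nonneg (by linarith [half_lt_log hx]) _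
  rw [summatory_mul, Finset.sum_mul]
  calc _ ≤ ∑ m ∈ Finset.Icc 1 ⌊x⌋₊,
        C * (x * Real.log x ^ j) * (properPowerWeight m * (1 + Real.log m) / m) := by
        refine Finset.sum_le_sum fun m hm => ?_
        obtain ⟨a, b⟩ := le_of_mem_Icc_floor hm
        have hy : 1 ≤ x / m := by rw [le_div_iff₀ (by linarith)]; linarith
        have h1 := h x hx (x / m) hy (div_le_self (by linarith) a)
        -- Splits `log x` between the two variables: one factor is paid by the bound for `Λ_j`, the
        -- other by the convergent sum over `m`.
        have hlog : Real.log x ≤ (1 + Real.log (x / m)) * (1 + Real.log m) := by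
          have e : Real.log x = Real.log (x / m) + Real.log m := by
            rw [Real.log_div (by linarith) (by linarith)]; ring
          have := Real.log_nonneg hy
          have := Real.log_nonneg a
          rw [e]; nlinarith
        have hT := summatory_nonneg (vonMangoldtConv_nonneg j) (x / m)
        have hw0 := properPowerWeight_nonneg m
        have hl := Real.log_nonneg a
        calc properPowerWeight m * summatory (vonMangoldtConv j) (x / m) * Real.log x
            ≤ properPowerWeight m * summatory (vonMangoldtConv j) (x / m) *
              ((1 + Real.log (x / m)) * (1 + Real.log m)) := by gcongr
          _ = properPowerWeight m * (1 + Real.log m) *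
              (summatory (vonMangoldtConv j) (x / m) * (1 + Real.log (x / m))) := by ring
          _ ≤ properPowerWeight m * (1 + Real.log m) * (C * (x / m * Real.log x ^ j)) := by
              gcongr
          _ = _ := by ring
    _ = C * (x * Real.log x ^ j) *
        ∑ m ∈ Finset.Icc 1 ⌊x⌋₊, properPowerWeight m * (1 + Real.log m) / m := by
        rw [Finset.mul_sum]
    _ ≤ C * (x * Real.log x ^ j) * W := by gcongr; exact hw _
    _ = _ := by ring

/-- Restricting to non-squarefree integers saves a logarithm. The saving is written as a factor `log
x` on the left since for `l = 0` it would be a negative power. -/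
theorem exists_summatory_nonSquarefreePart_le (l : ℕ) :
    ∃ C : ℝ, 0 ≤ C ∧ ∀ x : ℝ, 2 ≤ x →
      summatory (nonSquarefreePart (vonMangoldtConv (l + 1))) x * Real.log x ≤
        C * (x * Real.log x ^ l) := by
  cases l with
  | zero =>
    obtain ⟨C, hC, h⟩ := exists_summatory_properPowerWeight_mul_le 0
    refine ⟨C, hC, fun x hx => le_trans ?_ (h x hx)⟩
    have := half_lt_log hx
    gcongr
    refine Finset.sum_le_sum fun n _ => ?_
    rw [vonMangoldtConv_zero, mul_one, zero_add, vonMangoldtConv_one]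
    exact nonSquarefreePart_vonMangoldt_le n
  | succ l =>
    obtain ⟨C₀, hC₀, h₀⟩ := exists_nonSquarefreePart_vonMangoldtConv_le l
    obtain ⟨C₁, hC₁, h₁⟩ := exists_summatory_properPowerWeight_mul_le (l + 1)
    obtain ⟨C₂, hC₂, h₂⟩ := exists_summatory_properPowerWeight_mul_le l
    refine ⟨C₀ * (C₁ + 2 * C₂), by positivity, fun x hx => ?_⟩
    have hL := half_lt_log hx
    have hLl : 0 ≤ Real.log x ^ l := pow_nonneg (by linarith) _
    calc _ ≤ C₀ * (summatory (properPowerWeight * vonMangoldtConv (l + 1)) x +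
          summatory (properPowerWeight * vonMangoldtConv l) x) * Real.log x := by
          gcongr
          rw [summatory, summatory, summatory, ← Finset.sum_add_distrib, Finset.mul_sum]
          exact Finset.sum_le_sum fun n _ => h₀ n
      _ = C₀ * (summatory (properPowerWeight * vonMangoldtConv (l + 1)) x * Real.log x +
          summatory (properPowerWeight * vonMangoldtConv l) x * Real.log x) := by ring
      _ ≤ C₀ * (C₁ * (x * Real.log x ^ (l + 1)) + C₂ * (x * Real.log x ^ l)) := by
          exact mul_le_mul_of_nonneg_left (add_le_add (h₁ x hx) (h₂ x hx)) hC₀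
      _ ≤ C₀ * (C₁ * (x * Real.log x ^ (l + 1)) + C₂ * (x * (2 * Real.log x ^ (l + 1)))) := by
          gcongr
          rw [pow_succ]; nlinarith
      _ = _ := by ring

theorem nonSquarefreePart_one (f : ArithmeticFunction ℝ) : nonSquarefreePart f 1 = 0 :=
  nonSquarefreePart_of_squarefree f squarefree_one

/-- The contribution of the integers that are not squarefree. -/
theorem exists_sum_log_pow_mul_nonSquarefreePart_le (k l : ℕ) :
    ∃ C : ℝ, 0 ≤ C ∧ ∀ x : ℝ, 1 ≤ x →
      ∑ n ∈ Finset.Icc 1 ⌊x⌋₊,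
        Real.log n ^ (k + 1) * nonSquarefreePart (vonMangoldtConv (l + 1)) n ≤
        C * (x * Real.log x ^ (k + l)) := by
  obtain ⟨C, hC, h⟩ := exists_summatory_nonSquarefreePart_le l
  refine ⟨C, hC, fun x hx => ?_⟩
  have hL := Real.log_nonneg hx
  have hnn := nonSquarefreePart_nonneg (vonMangoldtConv_nonneg (l + 1))
  have h1 : ∑ n ∈ Finset.Icc 1 ⌊x⌋₊,
        Real.log n ^ (k + 1) * nonSquarefreePart (vonMangoldtConv (l + 1)) n ≤
        Real.log x ^ (k + 1) * summatory (nonSquarefreePart (vonMangoldtConv (l + 1))) x := by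
    rw [summatory, Finset.mul_sum]
    refine Finset.sum_le_sum fun n hn => ?_
    obtain ⟨a, b⟩ := le_of_mem_Icc_floor hn
    have := hnn n
    have := Real.log_nonneg a
    have := Real.log_le_log (by linarith) b
    gcongr
  refine h1.trans ?_
  -- Near `x = 1` the right side may vanish, but for `x < 2` only `n = 1` occurs, and it is
  -- squarefree.
  rcases lt_or_ge x 2 with hx2 | hx2
  · rw [summatory_of_lt_two (nonSquarefreePart_one _) hx2, mul_zero]; positivity
  · calc _ = Real.log x ^ k *
          (summatory (nonSquarefreePart (vonMangoldtConv (l + 1))) x * Real.log x) := by ring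
      _ ≤ Real.log x ^ k * (C * (x * Real.log x ^ l)) :=
          mul_le_mul_of_nonneg_left (h x hx2) (by positivity)
      _ = _ := by ring

/-! ### Abel summation and the mean value of `Λ²`. -/

open MeasureTheory in
/-- Abel summation for the summatory function of an arithmetic function. -/
theorem sum_mul_eq_sub_integral_summatory (f : ArithmeticFunction ℝ) {φ φ' : ℝ → ℝ} {x : ℝ}
    (hx : 1 ≤ x) (hd : ∀ t ∈ Set.Icc 1 x, HasDerivAt φ (φ' t) t)
    (hc : ContinuousOn φ' (Set.Icc 1 x)) :
    ∑ n ∈ Finset.Icc 1 ⌊x⌋₊, φ n * f n =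
      φ x * summatory f x - ∫ t in (1 : ℝ)..x, φ' t * summatory f t := by
  have hder : Set.EqOn φ' (deriv φ) (Set.Icc 1 x) := fun t ht => (hd t ht).deriv.symm
  have h := sum_mul_eq_sub_integral_mul₀ (f := φ) (c := f) (f.map_zero) x
    (fun t ht => (hd t ht).differentiableAt)
    (hc.integrableOn_Icc.congr_fun hder measurableSet_Icc)
  have e : ∀ (g : ℕ → ℝ) (m : ℕ), g 0 = 0 →
      ∑ n ∈ Finset.Icc 0 m, g n = ∑ n ∈ Finset.Icc 1 m, g n := by
    intro g m hg
    rw [← Finset.add_sum_Ioc_eq_sum_Icc (Nat.zero_le m), hg, zero_add]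
    rfl
  rw [e _ _ (by simp), e _ _ f.map_zero] at h
  rw [h, summatory, intervalIntegral.integral_of_le hx]
  congr 1
  refine setIntegral_congr_fun measurableSet_Ioc fun t ht => ?_
  rw [e _ _ f.map_zero, ← hder ⟨ht.1.le, ht.2⟩, summatory]

open MeasureTheory in
theorem intervalIntegrable_mul_summatory (f : ArithmeticFunction ℝ) {g : ℝ → ℝ} {x : ℝ}
    (hx : 1 ≤ x) (hc : ContinuousOn g (Set.Icc 1 x)) :
    IntervalIntegrable (fun t => g t * summatory f t) volume 1 x := by
  rw [intervalIntegrable_iff_integrableOn_Icc_of_le hx]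
  exact integrableOn_mul_sum_Icc (m := 1) f zero_le_one hc.integrableOn_Icc

/-- Here the prime number theorem enters: the boundary term `ψ(x) log x` has error `O(x)` exactly
when `ψ(x) - x = O(x / log x)`. The integral only needs Chebyshev's bound. -/
theorem exists_abs_sum_vonMangoldt_mul_log_sub_le :
    ∃ C : ℝ, 0 ≤ C ∧ ∀ x : ℝ, 1 ≤ x →
      |∑ n ∈ Finset.Icc 1 ⌊x⌋₊, Real.log n * ArithmeticFunction.vonMangoldt n -
        x * Real.log x| ≤ C * x := by
  obtain ⟨K, hK, h⟩ := exists_abs_psi_sub_mul_log_le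
  refine ⟨K + 7, by positivity, fun x hx => ?_⟩
  rw [sum_mul_eq_sub_integral_summatory ArithmeticFunction.vonMangoldt (φ := Real.log)
    (φ' := fun t => t⁻¹) hx
    (fun t ht => Real.hasDerivAt_log (by linarith [ht.1]))
    (continuousOn_id.inv₀ fun t ht => by simp only [id]; linarith [ht.1])]
  have hint : |∫ t in (1 : ℝ)..x, t⁻¹ * summatory ArithmeticFunction.vonMangoldt t| ≤ 7 * x := by
    have := intervalIntegral.norm_integral_le_of_norm_le_const (a := 1) (b := x) (C := 7)
      (f := fun t => t⁻¹ * summatory ArithmeticFunction.vonMangoldt t) (fun t ht => by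
        rw [Set.uIoc_of_le hx] at ht
        have ht0 : 0 < t := by linarith [ht.1]
        rw [Real.norm_of_nonneg (mul_nonneg (by positivity) (summatory_nonneg
          (fun _ => ArithmeticFunction.vonMangoldt_nonneg) t)), inv_mul_le_iff₀ ht0]
        linarith [summatory_vonMangoldt_le ht0.le])
    rw [Real.norm_eq_abs, abs_of_nonneg (by linarith : 0 ≤ x - 1)] at this
    linarith
  have h1 := h x hx
  have hL := Real.log_nonneg hx
  rw [← abs_of_nonneg hL, ← abs_mul] at h1
  rw [summatory_vonMangoldt]
  calc |Real.log x * Chebyshev.psi x -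
        (∫ t in (1 : ℝ)..x, t⁻¹ * summatory ArithmeticFunction.vonMangoldt t) - x * Real.log x|
      = |(Chebyshev.psi x - x) * Real.log x -
        ∫ t in (1 : ℝ)..x, t⁻¹ * summatory ArithmeticFunction.vonMangoldt t| := by ring_nf
    _ ≤ K * x + 7 * x := (abs_sub _ _).trans (add_le_add h1 hint)
    _ = _ := by ring

theorem exists_abs_summatory_vonMangoldtSq_sub_le :
    ∃ C : ℝ, 0 ≤ C ∧ ∀ x : ℝ, 1 ≤ x →
      |summatory vonMangoldtSq x - x * Real.log x| ≤ C * x := by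
  obtain ⟨C₁, hC₁, h₁⟩ := exists_abs_sum_vonMangoldt_mul_log_sub_le
  obtain ⟨C₂, hC₂, h₂⟩ := exists_sum_log_pow_mul_nonSquarefreePart_le 0 0
  refine ⟨C₁ + C₂, by positivity, fun x hx => ?_⟩
  have hterm : ∀ n ∈ Finset.Icc 1 ⌊x⌋₊,
      |vonMangoldtSq n - Real.log n * ArithmeticFunction.vonMangoldt n| ≤
        Real.log n ^ (0 + 1) * nonSquarefreePart (vonMangoldtConv (0 + 1)) n := by
    intro n hn
    rw [zero_add, pow_one, vonMangoldtConv_one, vonMangoldtSq_apply]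
    have hΛ := ArithmeticFunction.vonMangoldt_nonneg (n := n)
    have hl := ArithmeticFunction.vonMangoldt_le_log (n := n)
    by_cases hs : Squarefree n
    · rw [nonSquarefreePart_of_squarefree _ hs, mul_zero]
      refine le_of_eq (abs_eq_zero.2 ?_)
      by_cases hpp : IsPrimePow n
      · have hp : n.Prime := by
          obtain ⟨p, m, hp, hm, rfl⟩ := (isPrimePow_nat_iff _).1 hpp
          by_cases hm1 : m = 1
          · rw [hm1, pow_one]; exact hp
          · exact absurd ((Nat.squarefree_pow_iff hp.one_lt.ne' hm.ne').1 hs).2 hm1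
        rw [ArithmeticFunction.vonMangoldt_apply_prime hp]; ring
      · rw [ArithmeticFunction.vonMangoldt_eq_zero_iff.2 hpp]; ring
    · rw [nonSquarefreePart_of_not_squarefree _ hs, abs_le]
      constructor <;> nlinarith
  have hsum : |summatory vonMangoldtSq x -
      ∑ n ∈ Finset.Icc 1 ⌊x⌋₊, Real.log n * ArithmeticFunction.vonMangoldt n| ≤ C₂ * x := by
    rw [summatory, ← Finset.sum_sub_distrib]
    refine (Finset.abs_sum_le_sum_abs _ _).trans ((Finset.sum_le_sum hterm).trans ?_)
    simpa using h₂ x hx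
  have := h₁ x hx
  calc _ ≤ |summatory vonMangoldtSq x -
        ∑ n ∈ Finset.Icc 1 ⌊x⌋₊, Real.log n * ArithmeticFunction.vonMangoldt n| +
        |∑ n ∈ Finset.Icc 1 ⌊x⌋₊, Real.log n * ArithmeticFunction.vonMangoldt n -
          x * Real.log x| := abs_sub_le _ _ _
    _ ≤ _ := by linarith

/-! ### Mean values of the convolution powers of `Λ²`. -/

/-- After `v = log t` this is a Beta integral. With `m = 2k + 1` its denominator `(2k + 2)(2k + 3)`
turns `(2k + 1)!` into `(2k + 3)!`. -/
theorem integral_div_mul_log_pow {x : ℝ} (hx : 1 ≤ x) (m : ℕ) :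
    ∫ t in (1 : ℝ)..x, x / t * (Real.log x - Real.log t) * Real.log t ^ m =
      x * Real.log x ^ (m + 2) / ((m + 1) * (m + 2)) := by
  set L := Real.log x with hL
  have hd : ∀ t ∈ Set.uIcc 1 x, HasDerivAt (fun t => x * (L * Real.log t ^ (m + 1) / (m + 1) -
      Real.log t ^ (m + 2) / (m + 2))) (x / t * (L - Real.log t) * Real.log t ^ m) t := by
    intro t ht
    rw [Set.uIcc_of_le hx] at ht
    have ht0 : t ≠ 0 := by linarith [ht.1]
    have hl := Real.hasDerivAt_log ht0
    have h1 := (((hl.pow (m + 1)).const_mul L).div_const ((m : ℝ) + 1)).sub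
      ((hl.pow (m + 2)).div_const ((m : ℝ) + 2))
    refine (h1.const_mul x).congr_deriv ?_
    have a1 : (m : ℝ) + 1 ≠ 0 := by positivity
    have a2 : (m : ℝ) + 2 ≠ 0 := by positivity
    simp only [Nat.add_sub_cancel, show m + 2 - 1 = m + 1 from rfl]
    push_cast
    field_simp
    ring
  have hc : ContinuousOn (fun t => x / t * (L - Real.log t) * Real.log t ^ m) (Set.uIcc 1 x) := by
    rw [Set.uIcc_of_le hx]
    have hne : ∀ t ∈ Set.Icc 1 x, t ≠ 0 := fun t ht => by linarith [ht.1]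
    have hlog : ContinuousOn Real.log (Set.Icc 1 x) := ContinuousOn.log continuousOn_id hne
    exact ((continuousOn_const.div continuousOn_id hne).mul (continuousOn_const.sub hlog)).mul
      (hlog.pow m)
  rw [intervalIntegral.integral_eq_sub_of_hasDerivAt hd hc.intervalIntegrable]
  simp only [Real.log_one, ← hL]
  have a1 : (m : ℝ) + 1 ≠ 0 := by positivity
  have a2 : (m : ℝ) + 2 ≠ 0 := by positivity
  field_simp
  ring

theorem integral_const_div {x : ℝ} (hx : 1 ≤ x) (c : ℝ) :
    ∫ t in (1 : ℝ)..x, c / t = c * Real.log x := by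
  simp_rw [div_eq_mul_inv]
  rw [intervalIntegral.integral_const_mul, integral_inv_of_pos one_pos (by linarith), div_one]

theorem intervalIntegrable_const_div {x : ℝ} (hx : 1 ≤ x) (c : ℝ) :
    IntervalIntegrable (fun t => c / t) MeasureTheory.volume 1 x := by
  refine ContinuousOn.intervalIntegrable ?_
  rw [Set.uIcc_of_le hx]
  exact continuousOn_const.div continuousOn_id fun t ht => by linarith [ht.1]

theorem vonMangoldtSq_pow_succ_one (k : ℕ) : (vonMangoldtSq ^ (k + 1)) 1 = 0 := by
  refine le_antisymm ?_ (ArithmeticFunction.pow_nonneg' vonMangoldtSq_nonneg _ _)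
  have := vonMangoldtSq_pow_le (k + 1) one_ne_zero
  simpa using this

/-- The step from `k + 1` to `k + 2` factors for `x ≥ 2`. -/
theorem abs_summatory_vonMangoldtSq_pow_succ_sub_le {k : ℕ} {C C₁ : ℝ} (hC : 0 ≤ C) (hC₁ : 0 ≤ C₁)
    (h₁ : ∀ x : ℝ, 1 ≤ x → |summatory vonMangoldtSq x - x * Real.log x| ≤ C₁ * x)
    (h : ∀ x : ℝ, 1 ≤ x → |summatory (vonMangoldtSq ^ (k + 1)) x -
      x * Real.log x ^ (2 * k + 1) / (2 * k + 1).factorial| ≤ C * (x * Real.log x ^ (2 * k)))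
    {x : ℝ} (hx : 2 ≤ x) :
    |summatory (vonMangoldtSq ^ (k + 2)) x -
      x * Real.log x ^ (2 * k + 3) / (2 * k + 3).factorial| ≤
      (3 * C₁ * (1 + 2 * C) + (3 * C + 1)) * (x * Real.log x ^ (2 * k + 2)) := by
  have hx1 : 1 ≤ x := by linarith
  have hx0 : 0 < x := by linarith
  have hL := half_lt_log hx
  set L := Real.log x with hLdef
  have hL0 : 0 < L := by linarith
  set S := summatory (vonMangoldtSq ^ (k + 1)) with hS
  set F : ℝ := ((2 * k + 1).factorial : ℝ) with hF
  have hF1 : 1 ≤ F := by rw [hF]; exact_mod_cast Nat.factorial_pos _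
  have hne : ∀ t ∈ Set.Icc 1 x, t ≠ 0 := fun t ht => by linarith [ht.1]
  have hlogc : ContinuousOn Real.log (Set.Icc 1 x) := ContinuousOn.log continuousOn_id hne
  have hlt : ∀ t, 1 ≤ t → t ≤ x → 0 ≤ Real.log t ∧ Real.log t ≤ L := fun t h1 h2 =>
    ⟨Real.log_nonneg h1, Real.log_le_log (by linarith) h2⟩
  have hB0 : ∀ n, 0 ≤ (vonMangoldtSq ^ (k + 1)) n :=
    ArithmeticFunction.pow_nonneg' vonMangoldtSq_nonneg _
  have hE : ∀ t, 1 ≤ t → t ≤ x →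
      |S t - t * Real.log t ^ (2 * k + 1) / F| ≤ C * (t * L ^ (2 * k)) := by
    intro t a b
    obtain ⟨c, d⟩ := hlt t a b
    refine (h t a).trans ?_
    gcongr
  have hmain : ∀ t, 1 ≤ t → t ≤ x → |Real.log t ^ (2 * k + 1) / F| ≤ L ^ (2 * k + 1) := by
    intro t a b
    obtain ⟨c, d⟩ := hlt t a b
    rw [abs_of_nonneg (by positivity)]
    calc _ ≤ Real.log t ^ (2 * k + 1) := div_le_self (by positivity) hF1
      _ ≤ _ := by gcongr
  have hLL : L ^ (2 * k) ≤ 2 * L ^ (2 * k + 1) := by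
    rw [pow_succ]; nlinarith [pow_pos hL0 (2 * k)]
  have hLL2 : L ^ (2 * k + 1) ≤ 2 * L ^ (2 * k + 2) := by
    rw [pow_succ L (2 * k + 1)]; nlinarith [pow_pos hL0 (2 * k + 1)]
  have hSb : ∀ t, 1 ≤ t → t ≤ x → S t ≤ (1 + 2 * C) * L ^ (2 * k + 1) * t := by
    intro t a b
    have h1 := (abs_le.1 (hE t a b)).2
    have h2 := (abs_le.1 (hmain t a b)).2
    have h3 : t * Real.log t ^ (2 * k + 1) / F ≤ t * L ^ (2 * k + 1) := by
      rw [mul_div_assoc]; gcongr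
    have h4 : C * (t * L ^ (2 * k)) ≤ C * (t * (2 * L ^ (2 * k + 1))) := by gcongr
    linarith
  have hS0 : ∀ t, 0 ≤ S t := summatory_nonneg hB0
  have hM : ∑ n ∈ Finset.Icc 1 ⌊x⌋₊, (n : ℝ)⁻¹ * (vonMangoldtSq ^ (k + 1)) n ≤
      3 * (1 + 2 * C) * L ^ (2 * k + 2) := by
    rw [sum_mul_eq_sub_integral_summatory (vonMangoldtSq ^ (k + 1)) (φ := fun t => t⁻¹)
      (φ' := fun t => -(t ^ 2)⁻¹) hx1 (fun t ht => hasDerivAt_inv (hne t ht))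
      (((continuousOn_id.pow 2).inv₀ fun t ht => pow_ne_zero 2 (hne t ht)).neg)]
    have hi := intervalIntegral.norm_integral_le_of_norm_le hx1
      (f := fun t => -(t ^ 2)⁻¹ * S t) (g := fun t => (1 + 2 * C) * L ^ (2 * k + 1) / t)
      (Filter.Eventually.of_forall fun t ht => by
        have ht0 : 0 < t := by linarith [ht.1]
        rw [norm_mul, norm_neg, Real.norm_of_nonneg (by positivity), Real.norm_of_nonneg (hS0 t)]
        calc (t ^ 2)⁻¹ * S t ≤ (t ^ 2)⁻¹ * ((1 + 2 * C) * L ^ (2 * k + 1) * t) := by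
              gcongr; exact hSb t ht.1.le ht.2
          _ = _ := by field_simp)
      (intervalIntegrable_const_div hx1 _)
    rw [integral_const_div hx1] at hi
    have h1 : x⁻¹ * S x ≤ (1 + 2 * C) * L ^ (2 * k + 1) := by
      rw [inv_mul_le_iff₀ hx0]
      linarith [hSb x hx1 le_rfl]
    have h2 := (abs_le.1 hi).1
    have h3 : (1 + 2 * C) * L ^ (2 * k + 1) ≤ (1 + 2 * C) * (2 * L ^ (2 * k + 2)) := by gcongr
    have h4 : (1 + 2 * C) * L ^ (2 * k + 1) * L = (1 + 2 * C) * L ^ (2 * k + 2) := by ring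
    rw [← hLdef, h4] at h2
    linarith
  -- The inner sum of `Λ²` up to `x / n` is replaced by its main term; the errors `O(x / n)` add up
  -- through the logarithmic mean `hM`.
  have hA : |summatory (vonMangoldtSq ^ (k + 2)) x -
      ∑ n ∈ Finset.Icc 1 ⌊x⌋₊, x / n * (L - Real.log n) * (vonMangoldtSq ^ (k + 1)) n| ≤
      C₁ * x * (3 * (1 + 2 * C) * L ^ (2 * k + 2)) := by
    rw [show k + 2 = (k + 1) + 1 from rfl, pow_succ vonMangoldtSq (k + 1), summatory_mul,
      ← Finset.sum_sub_distrib]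
    refine (Finset.abs_sum_le_sum_abs _ _).trans ?_
    refine le_trans (Finset.sum_le_sum (g := fun n : ℕ =>
      C₁ * x * ((n : ℝ)⁻¹ * (vonMangoldtSq ^ (k + 1)) n)) fun n hn => ?_) ?_
    · obtain ⟨a, b⟩ := le_of_mem_Icc_floor hn
      have hn0 : (0 : ℝ) < n := by linarith
      have h1' := h₁ (x / n) (by rw [le_div_iff₀ hn0]; linarith)
      rw [Real.log_div hx0.ne' hn0.ne'] at h1'
      rw [show (vonMangoldtSq ^ (k + 1)) n * summatory vonMangoldtSq (x / n) -
        x / n * (L - Real.log n) * (vonMangoldtSq ^ (k + 1)) n = (vonMangoldtSq ^ (k + 1)) n *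
          (summatory vonMangoldtSq (x / n) - x / n * (L - Real.log n)) by ring, abs_mul,
        abs_of_nonneg (hB0 n)]
      calc _ ≤ (vonMangoldtSq ^ (k + 1)) n * (C₁ * (x / n)) :=
            mul_le_mul_of_nonneg_left h1' (hB0 n)
        _ = _ := by rw [div_eq_mul_inv]; ring
    · rw [← Finset.mul_sum]
      gcongr
  have hBsum : |∑ n ∈ Finset.Icc 1 ⌊x⌋₊, x / n * (L - Real.log n) * (vonMangoldtSq ^ (k + 1)) n -
      x * L ^ (2 * k + 3) / (2 * k + 3).factorial| ≤ x * (3 * C + 1) * L ^ (2 * k + 2) := by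
    have hcφ : ContinuousOn (fun t : ℝ => -(x / t ^ 2 * (L - Real.log t + 1))) (Set.Icc 1 x) :=
      ((continuousOn_const.div (continuousOn_id.pow 2) fun t ht => pow_ne_zero 2 (hne t ht)).mul
        ((continuousOn_const.sub hlogc).add continuousOn_const)).neg
    rw [sum_mul_eq_sub_integral_summatory (vonMangoldtSq ^ (k + 1))
      (φ := fun t => x / t * (L - Real.log t))
      (φ' := fun t => -(x / t ^ 2 * (L - Real.log t + 1))) hx1 (fun t ht => by
        have ht0 := hne t ht
        have := ((hasDerivAt_inv ht0).const_mul x).mul ((Real.hasDerivAt_log ht0).const_sub L)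
        refine this.congr_deriv ?_
        field_simp
        ring) hcφ]
    -- The boundary term vanishes because the weight `x / t * (L - log t)` is zero at `t = x`.
    rw [← hLdef, sub_self, mul_zero, zero_mul, zero_sub]
    have hint := integral_div_mul_log_pow hx1 (2 * k + 1)
    have hfac : x * L ^ (2 * k + 3) / (2 * k + 3).factorial =
        (∫ t in (1 : ℝ)..x, x / t * (L - Real.log t) * Real.log t ^ (2 * k + 1)) / F := by
      rw [hint, hF, show 2 * k + 3 = (2 * k + 1) + 2 from rfl, Nat.factorial_succ,
        Nat.factorial_succ]
      push_cast
      field_simp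
      ring
    have hP : IntervalIntegrable
        (fun t => x / t * (L - Real.log t) * Real.log t ^ (2 * k + 1) / F)
        MeasureTheory.volume 1 x := by
      refine ContinuousOn.intervalIntegrable ?_
      rw [Set.uIcc_of_le hx1]
      exact (((continuousOn_const.div continuousOn_id hne).mul
        (continuousOn_const.sub hlogc)).mul (hlogc.pow _)).div_const F
    have hS' : IntervalIntegrable (fun t => -(-(x / t ^ 2 * (L - Real.log t + 1)) *
        summatory (vonMangoldtSq ^ (k + 1)) t)) MeasureTheory.volume 1 x :=
      (intervalIntegrable_mul_summatory _ hx1 hcφ).neg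
    rw [hfac, ← intervalIntegral.integral_div, ← intervalIntegral.integral_neg,
      ← intervalIntegral.integral_sub hS' hP]
    have hi := intervalIntegral.norm_integral_le_of_norm_le hx1
      (f := fun t => -(-(x / t ^ 2 * (L - Real.log t + 1)) * S t) -
        x / t * (L - Real.log t) * Real.log t ^ (2 * k + 1) / F)
      (g := fun t => x * (3 * C + 1) * L ^ (2 * k + 1) / t)
      (Filter.Eventually.of_forall fun t ht => by
        have ht0 : 0 < t := by linarith [ht.1]
        obtain ⟨l0, l1⟩ := hlt t ht.1.le ht.2
        have e1 := hE t ht.1.le ht.2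
        have e2 := hmain t ht.1.le ht.2
        -- The integrand minus its main part consists of the error in `S t` and the contribution of
        -- the `+ 1` in the derivative, which has one logarithm less. Since `L > 1/2`, `L - log t +
        -- 1 ≤ 3 L`.
        rw [Real.norm_eq_abs, show -(-(x / t ^ 2 * (L - Real.log t + 1)) * S t) -
          x / t * (L - Real.log t) * Real.log t ^ (2 * k + 1) / F =
          x / t ^ 2 * (L - Real.log t + 1) * (S t - t * Real.log t ^ (2 * k + 1) / F) +
          x / t * (Real.log t ^ (2 * k + 1) / F) by field_simp; ring]
        refine (abs_add_le _ _).trans ?_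
        have hpos : 0 ≤ x / t ^ 2 * (L - Real.log t + 1) :=
          mul_nonneg (by positivity) (by linarith)
        rw [abs_mul, abs_mul (x / t), abs_of_nonneg hpos, abs_of_nonneg (by positivity : 0 ≤ x / t)]
        calc _ ≤ x / t ^ 2 * (3 * L) * (C * (t * L ^ (2 * k))) + x / t * L ^ (2 * k + 1) := by
              gcongr
              linarith
          _ = _ := by field_simp; ring)
      (intervalIntegrable_const_div hx1 _)
    rw [integral_const_div hx1] at hi
    refine hi.trans (le_of_eq ?_)
    rw [← hLdef]; ring
  calc _ ≤ |summatory (vonMangoldtSq ^ (k + 2)) x -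
        ∑ n ∈ Finset.Icc 1 ⌊x⌋₊, x / n * (L - Real.log n) * (vonMangoldtSq ^ (k + 1)) n| +
      |∑ n ∈ Finset.Icc 1 ⌊x⌋₊, x / n * (L - Real.log n) * (vonMangoldtSq ^ (k + 1)) n -
        x * L ^ (2 * k + 3) / (2 * k + 3).factorial| := abs_sub_le _ _ _
    _ ≤ C₁ * x * (3 * (1 + 2 * C) * L ^ (2 * k + 2)) + x * (3 * C + 1) * L ^ (2 * k + 2) :=
      add_le_add hA hBsum
    _ = _ := by ring

theorem exists_abs_summatory_vonMangoldtSq_pow_sub_le (k : ℕ) :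
    ∃ C : ℝ, 0 ≤ C ∧ ∀ x : ℝ, 1 ≤ x → |summatory (vonMangoldtSq ^ (k + 1)) x -
      x * Real.log x ^ (2 * k + 1) / (2 * k + 1).factorial| ≤ C * (x * Real.log x ^ (2 * k)) := by
  obtain ⟨C₁, hC₁, h₁⟩ := exists_abs_summatory_vonMangoldtSq_sub_le
  induction k with
  | zero => exact ⟨C₁, hC₁, fun x hx => by simpa using h₁ x hx⟩
  | succ k ih =>
    obtain ⟨C, hC, h⟩ := ih
    refine ⟨(3 * C₁ * (1 + 2 * C) + (3 * C + 1)), by positivity, fun x hx => ?_⟩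
    rcases lt_or_ge x 2 with hx2 | hx2
    · have hL0 := Real.log_nonneg hx
      have hL1 : Real.log x ≤ 1 := by
        have := Real.log_le_sub_one_of_pos (by linarith : 0 < x)
        linarith
      rw [summatory_of_lt_two (vonMangoldtSq_pow_succ_one _) hx2, zero_sub, abs_neg,
        abs_of_nonneg (by positivity)]
      have hF : (1 : ℝ) ≤ (2 * (k + 1) + 1).factorial := by exact_mod_cast Nat.factorial_pos _
      calc _ ≤ x * Real.log x ^ (2 * (k + 1) + 1) := div_le_self (by positivity) hF
        _ ≤ 1 * (x * Real.log x ^ (2 * (k + 1))) := by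
          rw [one_mul]
          gcongr x * ?_
          exact pow_le_pow_of_le_one hL0 hL1 (Nat.le_succ _)
        _ ≤ _ := by
          gcongr
          have : 0 ≤ C₁ * (1 + 2 * C) := by positivity
          linarith
    · exact abs_summatory_vonMangoldtSq_pow_succ_sub_le hC hC₁ h₁ h hx2

/-! ### The two estimates. -/

theorem mainTheorem7 :
    (∀ k l : ℕ, 1 ≤ l → l < k →
      ∃ C : ℝ, ∀ x : ℝ, 1 ≤ x →
        |vonMangoldtConvSum k l x| ≤ C * (x * Real.log x ^ (k + l - 2))) ∧
    (∀ k : ℕ, 1 ≤ k →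
      ∃ C : ℝ, ∀ x : ℝ, 1 ≤ x →
        |vonMangoldtConvSum k k x -
            (k.factorial : ℝ) / ((2 * k - 1).factorial : ℝ) * (x * Real.log x ^ (2 * k - 1))| ≤
          C * (x * Real.log x ^ (2 * k - 2))) := by
  constructor
  · intro k l hl hkl
    obtain ⟨l, rfl⟩ : ∃ m, l = m + 1 := ⟨l - 1, by omega⟩
    obtain ⟨k, rfl⟩ : ∃ m, k = m + 1 := ⟨k - 1, by omega⟩
    obtain ⟨C, _, h⟩ := exists_sum_log_pow_mul_nonSquarefreePart_le k l
    refine ⟨C, fun x hx => ?_⟩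
    rw [show k + 1 + (l + 1) - 2 = k + l by omega, vonMangoldtConvSum,
      abs_of_nonneg (Finset.sum_nonneg fun n _ =>
        mul_nonneg (vonMangoldtConv_nonneg _ _) (vonMangoldtConv_nonneg _ _))]
    refine (Finset.sum_le_sum fun n hn => ?_).trans (h x hx)
    have hn1 := (Finset.mem_Icc.1 hn).1
    exact vonMangoldtConv_mul_le_of_ne (by omega) (by omega)
  · intro k hk
    obtain ⟨k, rfl⟩ : ∃ m, k = m + 1 := ⟨k - 1, by omega⟩
    obtain ⟨C₁, _, h₁⟩ := exists_sum_log_pow_mul_nonSquarefreePart_le k k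
    obtain ⟨C₂, _, h₂⟩ := exists_abs_summatory_vonMangoldtSq_pow_sub_le k
    set F : ℝ := ((k + 1).factorial : ℝ) with hF
    have hF0 : 0 ≤ F := Nat.cast_nonneg _
    refine ⟨(1 + F) * C₁ + F * C₂, fun x hx => ?_⟩
    rw [show 2 * (k + 1) - 1 = 2 * k + 1 by omega, show 2 * (k + 1) - 2 = 2 * k by omega]
    have hd : |vonMangoldtConvSum (k + 1) (k + 1) x - F * summatory (vonMangoldtSq ^ (k + 1)) x| ≤
        (1 + F) * (C₁ * (x * Real.log x ^ (2 * k))) := by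
      rw [vonMangoldtConvSum, summatory, Finset.mul_sum, ← Finset.sum_sub_distrib]
      refine (Finset.abs_sum_le_sum_abs _ _).trans ?_
      have h := h₁ x hx
      rw [← two_mul] at h
      refine le_trans (Finset.sum_le_sum fun n hn => ?_)
        ((Finset.mul_sum _ _ _).symm.le.trans
          (mul_le_mul_of_nonneg_left h (by linarith : 0 ≤ 1 + F)))
      have hn1 := (Finset.mem_Icc.1 hn).1
      exact abs_vonMangoldtConv_sq_sub_le (k + 1) (by omega)
    have hm := mul_le_mul_of_nonneg_left (h₂ x hx) hF0
    rw [← abs_of_nonneg hF0, ← abs_mul, abs_of_nonneg hF0] at hm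
    calc _ = |(vonMangoldtConvSum (k + 1) (k + 1) x -
            F * summatory (vonMangoldtSq ^ (k + 1)) x) +
          F * (summatory (vonMangoldtSq ^ (k + 1)) x -
            x * Real.log x ^ (2 * k + 1) / (2 * k + 1).factorial)| := by
          congr 1; ring
      _ ≤ _ := (abs_add_le _ _).trans (add_le_add hd hm)
      _ = _ := by ring
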